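/- Let $f_1,\dots,f_m:\mathbb R^n\to\mathbb R$ be convex, $f=\sum_{i=1}^m f_i$, and let $X\subseteq\mathbb R^n$ be closed, convex and bounded. Let $\mathcal P_X$ be the Euclidean projection onto $X$, $f^*=\min_{x\in X}f(x)$, and $X^*$ the set of minimizers of $f$ over $X$. For each $i$ let $\nabla f_i$ be a measurable map such that, for every $x\in X$, $\nabla f_i(x)$ is a subgradient of $f_i$ at $x$, i.e. $\nabla f_i(x)^T(y-x)\le f_i(y)-f_i(x)$ for all $y\in\mathbb R^n$. Let $s(0),s(1),\dots$ be a time-nonhomogeneous Markov chain with states $1,\dots,m$ and transition matrices $P(k)$, $[P(k)]_{i,j}=\mathrm{Prob}\{s(k+1)=j\mid s(k)=i\}$, $k\ge0$, such that, for all $k\ge 0$: (i) $P(k)$ is doubly stochastic with positive diagonal entries; (ii) every positive entry of $P(k)$ is larger than $\eta$, for some constant $\eta>0$ independent of $k$; (iii) for some integer $Q\ge1$ independent of $k$, the directed graph on $\{1,\dots,m\}$ with edge set $\bigcup_{l=k}^{k+Q-1}\{(i,j): [P(l)]_{i,j}>0\}$ is strongly connected. Consider the Markov randomized incremental stochastic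 subgradient method $$x_{k+1}=\mathcal P_X\bigl[x_k-\alpha_{k+1}\bigl(\nabla f_{s(k+1)}(x_k)+\epsilon_{s(k+1),k+1}\bigr)\bigr],\qquad k\ge0,$$ where $x_0\in X$ is a random initial vector, the $\epsilon_{i,k}$ ($1\le i\le m$, $k\ge1$) are random noise vectors, and $\alpha_k=a/k^p$ with $a>0$ and $\tfrac23<p\le1$. Let $G_k$ be the $\sigma$-field generated by $x_0$, $s(0),\dots,s(k)$ and $\epsilon_{s(1),1},\dots,\epsilon_{s(k),k}$, and suppose that there are deterministic nonnegative scalars $\mu_k,\nu_k$ ($k\ge1$) such that, almost surely, for all $k\ge0$, $$\bigl\|\mathrm E[\epsilon_{s(k+1),k+1}\mid G_k]\bigr\|\le\mu_{k+1},\qquad \mathrm E\bigl[\|\epsilon_{s(k+1),k+1}\|^2\mid G_k\bigr]\le\nu_{k+1}^2,$$ $$\sum_{k=1}^\infty\alpha_k\mu_k<\infty,\qquad \sup_{k\ge1}\nu_k<\infty.$$ Then, with probability 1, $$\liminf_{k\to\infty}f(x_k)=f^*\qquad\text{and}\qquad\liminf_{k\to\infty}\operatorname{dist}(x_k,X^*)=0.$$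 -/

import Mathlib

open MeasureTheory ProbabilityTheory Filter Topology
open scoped InnerProductSpace

noncomputable section

/-- `g` is a subgradient of `φ` at `x`: `gᵀ (y - x) ≤ φ y - φ x` for every `y ∈ ℝⁿ`. -/
def IsSubgradientAt {n : ℕ} (φ : EuclideanSpace ℝ (Fin n) → ℝ)
    (g x : EuclideanSpace ℝ (Fin n)) : Prop :=
  ∀ y, ⟪g, y - x⟫_ℝ ≤ φ y - φ x

open Classical in
/-- Euclidean projection onto `X`: the point of `X` nearest to `z`. For a nonempty closed convex
set it exists and is unique; the value `z` is a placeholder for when there is no nearest point. -/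
def euclProj {n : ℕ} (X : Set (EuclideanSpace ℝ (Fin n))) (z : EuclideanSpace ℝ (Fin n)) :
    EuclideanSpace ℝ (Fin n) :=
  if h : ∃ p ∈ X, ∀ y ∈ X, dist z p ≤ dist z y then h.choose else z

theorem euclProj_spec {n : ℕ} {X : Set (EuclideanSpace ℝ (Fin n))} (hX : IsClosed X)
    (hne : X.Nonempty) (z : EuclideanSpace ℝ (Fin n)) :
    euclProj X z ∈ X ∧ ∀ y ∈ X, dist z (euclProj X z) ≤ dist z y := by
  have h : ∃ p ∈ X, ∀ y ∈ X, dist z p ≤ dist z y := by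
    obtain ⟨p, hp, hd⟩ := hX.exists_infDist_eq_dist hne z
    exact ⟨p, hp, fun y hy => hd ▸ Metric.infDist_le_dist_of_mem hy⟩
  rw [euclProj, dif_pos h]
  exact h.choose_spec

/-- The network objective `f = ∑ᵢ fᵢ`. -/
def netObjective {n m : ℕ} (f : Fin m → EuclideanSpace ℝ (Fin n) → ℝ)
    (x : EuclideanSpace ℝ (Fin n)) : ℝ :=
  ∑ i, f i x

/-- The optimal value `f* = inf_{x ∈ X} f(x)`. -/
def optimalValue {n : ℕ} (φ : EuclideanSpace ℝ (Fin n) → ℝ)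
    (X : Set (EuclideanSpace ℝ (Fin n))) : ℝ :=
  sInf (φ '' X)

/-- The optimal set `X*`, the set of minimizers of `φ` over `X`. -/
def optimalSet {n : ℕ} (φ : EuclideanSpace ℝ (Fin n) → ℝ)
    (X : Set (EuclideanSpace ℝ (Fin n))) : Set (EuclideanSpace ℝ (Fin n)) :=
  {x | x ∈ X ∧ ∀ y ∈ X, φ x ≤ φ y}

/-- On a nonempty compact `X` the optimal set is nonempty, so `Metric.infDist` to it is a
genuine distance. -/
theorem optimalSet_nonempty {n : ℕ} {φ : EuclideanSpace ℝ (Fin n) → ℝ}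
    {X : Set (EuclideanSpace ℝ (Fin n))} (hX : IsCompact X) (hne : X.Nonempty)
    (hφ : ContinuousOn φ X) : (optimalSet φ X).Nonempty := by
  obtain ⟨x, hx, hmin⟩ := hX.exists_isMinOn hne hφ
  exact ⟨x, hx, fun y hy => hmin hy⟩

/-- The step-size `α_k = a / k^p` (used for `k ≥ 1` only). -/
def stepSize (a p : ℝ) (k : ℕ) : ℝ := a / (k : ℝ) ^ p

/-- `s` is a time-nonhomogeneous Markov chain with state space `{1, …, m}` and with `P k` as
transition matrix from time `k` to time `k + 1`:
`Prob(s 0 = i 0, …, s (k+1) = i (k+1)) = Prob(s 0 = i 0, …, s k = i k) * [P k]_{i k, i (k+1)}`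
for every path `i`. -/
def IsMarkovChain {Ω : Type*} [MeasurableSpace Ω] (Pr : Measure Ω) {m : ℕ}
    (P : ℕ → Matrix (Fin m) (Fin m) ℝ) (s : ℕ → Ω → Fin m) : Prop :=
  (∀ k, Measurable (s k)) ∧
  ∀ (k : ℕ) (i : ℕ → Fin m),
    Pr.real {ω | ∀ l ≤ k + 1, s l ω = i l} =
      Pr.real {ω | ∀ l ≤ k, s l ω = i l} * P k (i k) (i (k + 1))

/-- For every `k`, the directed graph on `{1, …, m}` with edge set `E(k) ∪ ⋯ ∪ E(k + Q - 1)`,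
where `E(l) = {(i, j) | [P l]_{i,j} > 0}`, is strongly connected. -/
def StronglyConnectedWithin {m : ℕ} (P : ℕ → Matrix (Fin m) (Fin m) ℝ) (Q : ℕ) : Prop :=
  ∀ (k : ℕ) (i j : Fin m),
    Relation.ReflTransGen (fun u v : Fin m => ∃ l, k ≤ l ∧ l < k + Q ∧ 0 < P l u v) i j

/-- The noise `ε_{s(k),k}` that actually enters the update at time `k`. -/
def realizedNoise {Ω : Type*} {n m : ℕ} (ε : Fin m → ℕ → Ω → EuclideanSpace ℝ (Fin n))
    (s : ℕ → Ω → Fin m) (k : ℕ) (ω : Ω) : EuclideanSpace ℝ (Fin n) :=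
  ε (s k ω) k ω

/-- The history `G_k` of the method up to time `k`: the σ-algebra generated by `x₀`, by
`s(0), …, s(k)` and by the noise vectors `ε_{s(1),1}, …, ε_{s(k),k}`. -/
def history {Ω : Type*} {n m : ℕ} (x₀ : Ω → EuclideanSpace ℝ (Fin n)) (s : ℕ → Ω → Fin m)
    (ε : Fin m → ℕ → Ω → EuclideanSpace ℝ (Fin n)) (k : ℕ) : MeasurableSpace Ω :=
  MeasurableSpace.comap x₀ inferInstance ⊔
    (⨆ l ∈ Set.Iic k, MeasurableSpace.comap (s l) inferInstance) ⊔
    (⨆ l ∈ Set.Icc 1 k, MeasurableSpace.comap (realizedNoise ε s l) inferInstance)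

/-- The moment assumption on the noise: given the past `G_k`, the noise `ε_{s(k+1),k+1}` has
conditional mean of norm at most `μ_{k+1}` and conditional second moment at most `ν_{k+1}²`.
Square integrability is recorded explicitly, so that `condExp` is the true conditional
expectation (it also follows from the deterministic second moment bound). -/
def NoiseMomentBounds {Ω : Type*} [MeasurableSpace Ω] (Pr : Measure Ω) {n m : ℕ}
    (x₀ : Ω → EuclideanSpace ℝ (Fin n)) (s : ℕ → Ω → Fin m)
    (ε : Fin m → ℕ → Ω → EuclideanSpace ℝ (Fin n)) (μ ν : ℕ → ℝ) : Prop :=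
  ∀ k : ℕ,
    MemLp (realizedNoise ε s (k + 1)) 2 Pr ∧
    (∀ᵐ ω ∂Pr, ‖(Pr[realizedNoise ε s (k + 1) | history x₀ s ε k]) ω‖ ≤ μ (k + 1)) ∧
    (∀ᵐ ω ∂Pr,
      (Pr[fun ω' => ‖realizedNoise ε s (k + 1) ω'‖ ^ 2 | history x₀ s ε k]) ω ≤ ν (k + 1) ^ 2)

/-- The Markov randomized incremental stochastic subgradient method
`x_{k+1} = P_X [x_k - α_{k+1} (∇f_{s(k+1)}(x_k) + ε_{s(k+1),k+1})]`, where `g i x` is the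
subgradient `∇f_i(x)` used by agent `i` at `x`. -/
def markovIterate {Ω : Type*} {n m : ℕ} (X : Set (EuclideanSpace ℝ (Fin n)))
    (g : Fin m → EuclideanSpace ℝ (Fin n) → EuclideanSpace ℝ (Fin n)) (α : ℕ → ℝ)
    (s : ℕ → Ω → Fin m) (ε : Fin m → ℕ → Ω → EuclideanSpace ℝ (Fin n))
    (x₀ : Ω → EuclideanSpace ℝ (Fin n)) : ℕ → Ω → EuclideanSpace ℝ (Fin n)
  | 0, ω => x₀ ω
  | k + 1, ω =>
      euclProj X (markovIterate X g α s ε x₀ k ω -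
        α (k + 1) • (g (s (k + 1) ω) (markovIterate X g α s ε x₀ k ω) +
          realizedNoise ε s (k + 1) ω))

end

/-! Write A_k = α_{k+1}, σ_k = s(k+1), e_k = ε_{s(k+1),k+1}, and fix a minimizer y. Projection does
not increase the distance to y, so summing the one-step estimate of ‖x_k - y‖² bounds ∑ A_k
(f_{σ_k}(x_k) - f_{σ_k}(y)) by a constant minus ∑ A_k ⟪e_k, x_k - y⟫. That noise sum is bounded
below almost surely, as a convergent martingale plus a bias controlled by ∑ α_k μ_k.

Replacing f_{σ_k} by f/m leaves, for each i, the error ∑ A_k (1[σ_k = i] - 1/m) h_k with h_k =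
f_i(x_k) - f_i(y). The series without h_k converges almost surely: mixing towards the uniform law
solves a Poisson equation with solution of size O(A_k), which turns the partial sums into an
L²-bounded martingale plus telescoping terms. As h_k is bounded and moves by O(A_k (1 + ‖e_k‖)),
summation by parts makes the error O(1) + o(∑ A_k). Since ∑ A_k = ∞, f(x_k) - f(y) cannot stay above
any δ > 0; compactness transfers this to the distance from X*.

The two martingales live on different filtrations: the chain's own, where the Markov property is
given, and the history G_k, where the noise moments are given. They meet only in a pathwise argument
(`frequently_netObjective_sub_lt`), so s need not be Markov relative to G_k. -/

/-- The compensated sum of square-integrable increments whose second moments are summable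
converges almost surely. -/
theorem ae_exists_tendsto_sum_sub_condExp {Ω : Type*} {m0 : MeasurableSpace Ω} {Pr : Measure Ω}
    [IsProbabilityMeasure Pr] (ℱ : Filtration ℕ m0) (Z : ℕ → Ω → ℝ)
    (hZ : ∀ k, StronglyMeasurable[ℱ (k + 1)] (Z k)) (hL : ∀ k, MemLp (Z k) 2 Pr)
    (hsum : Summable fun k => ∫ ω, Z k ω ^ 2 ∂Pr) :
    ∀ᵐ ω ∂Pr, ∃ l, Tendsto
      (fun N => ∑ k ∈ Finset.range N, (Z k ω - (Pr[Z k | ℱ k]) ω)) atTop (𝓝 l) := by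
  set D : ℕ → Ω → ℝ := fun k => Z k - Pr[Z k | ℱ k] with hD
  set M : ℕ → Ω → ℝ := fun N => ∑ k ∈ Finset.range N, D k with hM
  have hMs : ∀ N, M (N + 1) = M N + D N := fun N => Finset.sum_range_succ _ _
  have hDmeas : ∀ k, StronglyMeasurable[ℱ (k + 1)] (D k) := fun k =>
    (hZ k).sub (stronglyMeasurable_condExp.mono (ℱ.mono (Nat.le_succ k)))
  have hDL : ∀ k, MemLp (D k) 2 Pr := fun k => (hL k).sub ((hL k).condExp one_le_two)
  have hMmeas : ∀ N, StronglyMeasurable[ℱ N] (M N) := by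
    intro N
    refine Finset.stronglyMeasurable_sum _ fun k hk => ?_
    exact (hDmeas k).mono (ℱ.mono (Nat.succ_le_of_lt (Finset.mem_range.1 hk)))
  have hML : ∀ N, MemLp (M N) 2 Pr := fun N => memLp_finsetSum' _ fun k _ => hDL k
  have hMint : ∀ N, Integrable (M N) Pr := fun N => (hML N).integrable one_le_two
  have hDint : ∀ N, Integrable (D N) Pr := fun N => (hDL N).integrable one_le_two
  have hDc : ∀ N, Pr[D N | ℱ N] =ᵐ[Pr] 0 := by
    intro N
    have h1 := condExp_sub ((hL N).integrable one_le_two)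
      (integrable_condExp (μ := Pr) (m := ℱ N) (f := Z N)) (ℱ N)
    have h2 : Pr[Pr[Z N | ℱ N] | ℱ N] = Pr[Z N | ℱ N] :=
      condExp_of_stronglyMeasurable (ℱ.le N) stronglyMeasurable_condExp integrable_condExp
    filter_upwards [h1] with ω hω
    rw [hω, h2]; simp
  have hmart : Martingale M ℱ Pr := by
    refine martingale_of_condExp_sub_eq_zero_nat hMmeas hMint fun N => ?_
    rw [hMs N, add_sub_cancel_left]; exact hDc N
  have hDsq : ∀ k, ∫ ω, D k ω ^ 2 ∂Pr ≤ ∫ ω, Z k ω ^ 2 ∂Pr := by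
    intro k
    have h1 := condVar_ae_le_condExp_sq (ℱ.le k) (hL k)
    have h2 := integral_mono_ae integrable_condVar integrable_condExp h1
    rw [condVar, integral_condExp (ℱ.le k), integral_condExp (ℱ.le k)] at h2
    exact h2
  have horth : ∀ N, ∫ ω, M N ω * D N ω ∂Pr = 0 := by
    intro N
    have hi : Integrable (M N * D N) Pr := (hML N).integrable_mul (hDL N)
    have h1 := condExp_mul_of_stronglyMeasurable_left (hMmeas N) hi (hDint N)
    have h2 := integral_condExp (μ := Pr) (f := M N * D N) (ℱ.le N)
    have h3 : Pr[M N * D N | ℱ N] =ᵐ[Pr] 0 := by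
      filter_upwards [h1, hDc N] with ω h h'
      rw [h]; simp [h']
    rw [integral_congr_ae h3] at h2
    simpa using h2.symm
  have hsq : ∀ N, ∫ ω, M N ω ^ 2 ∂Pr ≤ ∑ k ∈ Finset.range N, ∫ ω, Z k ω ^ 2 ∂Pr := by
    intro N
    induction N with
    | zero => simp [hM]
    | succ N ih =>
      have e : ∀ ω, M (N + 1) ω ^ 2 = M N ω ^ 2 + 2 * (M N ω * D N ω) + D N ω ^ 2 := by
        intro ω; rw [hMs]; simp only [Pi.add_apply]; ring
      have i1 := (hML N).integrable_sq
      have i2 := (hDL N).integrable_sq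
      have i3 : Integrable (fun ω => 2 * (M N ω * D N ω)) Pr :=
        ((hML N).integrable_mul (hDL N)).const_mul 2
      simp_rw [e]
      rw [integral_add (by exact i1.add i3) i2, integral_add i1 i3, integral_const_mul, horth,
        Finset.sum_range_succ]
      linarith [hDsq N]
  -- Submartingale convergence asks for an L¹ bound; |t| ≤ 1 + t² extracts it from the L² bound,
  -- whence the extra 1.
  have hbdd : ∀ N, eLpNorm (M N) 1 Pr ≤
      ((1 + ∑' k, ∫ ω, Z k ω ^ 2 ∂Pr).toNNReal : ENNReal) := by
    intro N
    rw [eLpNorm_one_eq_lintegral_enorm, ← ofReal_integral_norm_eq_lintegral_enorm (hMint N)]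
    refine ENNReal.ofReal_le_ofReal ?_
    have h1 : ∫ ω, ‖M N ω‖ ∂Pr ≤ ∫ ω, (1 + M N ω ^ 2) ∂Pr := by
      refine integral_mono (hMint N).norm ((integrable_const 1).add (hML N).integrable_sq) ?_
      intro ω
      simp only [Real.norm_eq_abs]
      nlinarith [sq_abs (M N ω), sq_nonneg (|M N ω| - 1)]
    rw [integral_add (integrable_const 1) (hML N).integrable_sq] at h1
    have h2 := hsum.sum_le_tsum (Finset.range N)
      (fun k _ => integral_nonneg fun ω => sq_nonneg (Z k ω))
    simp only [integral_const, probReal_univ, one_smul] at h1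
    linarith [hsq N]
  filter_upwards [hmart.submartingale.exists_ae_tendsto_of_bdd hbdd] with ω hω
  simpa [hM, hD, Finset.sum_apply] using hω

/-! ### The Markov property as a conditional expectation. -/

section Chain

variable {Ω : Type*} [MeasurableSpace Ω] {Pr : Measure Ω} {m : ℕ}
  {P : ℕ → Matrix (Fin m) (Fin m) ℝ} {s : ℕ → Ω → Fin m}

/-- The filtration generated by a discrete chain. -/
def chainFiltration (hs : ∀ k, Measurable (s k)) : Filtration ℕ ‹MeasurableSpace Ω› :=
  Filtration.natural s fun k => (hs k).stronglyMeasurable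

theorem measurable_chainFiltration (hs : ∀ k, Measurable (s k)) (k : ℕ) :
    Measurable[chainFiltration hs k] (s k) :=
  (Filtration.stronglyAdapted_natural fun k => (hs k).stronglyMeasurable) k |>.measurable

theorem IsMarkovChain.real_path_inter (hs : IsMarkovChain Pr P s) (k : ℕ)
    (b : Set.Iic k → Fin m) (j : Fin m) :
    Pr.real ((fun ω (l : Set.Iic k) => s l ω) ⁻¹' {b} ∩ s (k + 1) ⁻¹' {j}) =
      Pr.real ((fun ω (l : Set.Iic k) => s l ω) ⁻¹' {b}) * P k (b ⟨k, le_refl k⟩) j := by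
  -- The path is continued by the constant j after time k; only its value at k + 1 matters.
  have h := hs.2 k (fun l => if hl : l ≤ k then b ⟨l, hl⟩ else j)
  have e1 : {ω | ∀ l ≤ k, s l ω = if hl : l ≤ k then b ⟨l, hl⟩ else j} =
      (fun ω (l : Set.Iic k) => s l ω) ⁻¹' {b} := by
    ext ω
    simp only [Set.mem_ofPred_eq, Set.mem_preimage, Set.mem_singleton_iff, funext_iff]
    constructor
    · rintro h ⟨l, hl⟩
      have := h l hl
      rwa [dif_pos (show l ≤ k from hl)] at this
    · intro h l hl
      rw [dif_pos hl]; exact h ⟨l, hl⟩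
  have e2 : {ω | ∀ l ≤ k + 1, s l ω = if hl : l ≤ k then b ⟨l, hl⟩ else j} =
      (fun ω (l : Set.Iic k) => s l ω) ⁻¹' {b} ∩ s (k + 1) ⁻¹' {j} := by
    rw [← e1]
    ext ω
    simp only [Set.mem_ofPred_eq, Set.mem_inter_iff, Set.mem_preimage, Set.mem_singleton_iff]
    constructor
    · intro h
      refine ⟨fun l hl => h l (by omega), ?_⟩
      have := h (k + 1) le_rfl
      rwa [dif_neg (by omega)] at this
    · rintro ⟨h1, h2⟩ l hl
      rcases Nat.lt_or_ge k l with h | h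
      · obtain rfl : l = k + 1 := by omega
        rw [dif_neg (by omega)]; exact h2
      · exact h1 l h
  rw [e2, e1] at h
  simpa using h

/-- The Markov property: one-step conditional expectations are given by the transition matrix. -/
theorem IsMarkovChain.condExp_eq [IsProbabilityMeasure Pr] (hs : IsMarkovChain Pr P s) (k : ℕ) (v : Fin m → ℝ) :
    Pr[fun ω => v (s (k + 1) ω) | chainFiltration hs.1 k] =ᵐ[Pr]
      fun ω => (P k).mulVec v (s k ω) := by
  have hint : ∀ (u : Fin m → ℝ) l, Integrable (fun ω => u (s l ω)) Pr := by
    intro u l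
    refine Integrable.of_bound (C := ∑ i, |u i|)
      ((measurable_of_finite u).comp (hs.1 l)).aestronglyMeasurable (ae_of_all _ fun ω => ?_)
    exact Finset.single_le_sum (f := fun i => |u i|) (fun i _ => abs_nonneg _)
      (Finset.mem_univ (s l ω))
  symm
  refine ae_eq_condExp_of_forall_setIntegral_eq ((chainFiltration hs.1).le k) (hint v (k + 1))
    (fun A _ _ => (hint _ k).integrableOn) ?_
    (((measurable_of_finite ((P k).mulVec v)).comp (measurable_chainFiltration hs.1 k)).stronglyMeasurable
      |>.aestronglyMeasurable)
  intro A hA _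
  rw [chainFiltration, Filtration.natural_eq_comap] at hA
  obtain ⟨B, -, rfl⟩ := hA
  set T : Ω → (Set.Iic k → Fin m) := fun ω l => s l ω with hT
  have hTm : Measurable T := measurable_pi_lambda _ fun l => hs.1 l
  classical
  -- Path space up to time k is finite, so every event of the filtration is a finite disjoint union
  -- of single-path events, where the definition of the chain applies.
  have hB : T ⁻¹' B = ⋃ b ∈ (B.toFinite.toFinset), T ⁻¹' {b} := by
    ext ω; simp
  have hpart : ∀ F : Ω → ℝ, Integrable F Pr →
      ∫ ω in T ⁻¹' B, F ω ∂Pr = ∑ b ∈ B.toFinite.toFinset, ∫ ω in T ⁻¹' {b}, F ω ∂Pr := by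
    intro F hF
    rw [hB]
    refine integral_biUnion_finset _ (fun b _ => hTm (measurableSet_singleton b)) ?_
      (fun b _ => hF.integrableOn)
    intro b _ c _ hbc
    exact Disjoint.preimage _ (by simpa using hbc)
  rw [hpart _ (hint _ k), hpart _ (hint v (k + 1))]
  refine Finset.sum_congr rfl fun b _ => ?_
  have hbm : MeasurableSet (T ⁻¹' {b}) := hTm (measurableSet_singleton b)
  have e1 : ∫ ω in T ⁻¹' {b}, (P k).mulVec v (s k ω) ∂Pr =
      Pr.real (T ⁻¹' {b}) * (P k).mulVec v (b ⟨k, le_refl k⟩) := by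
    rw [setIntegral_congr_fun (g := fun _ => (P k).mulVec v (b ⟨k, le_refl k⟩)) hbm]
    · simp
    · intro ω hω
      have : T ω = b := hω
      simp only [← this, hT]
  have e2 : ∀ ω, v (s (k + 1) ω) = ∑ j, (s (k + 1) ⁻¹' {j}).indicator (fun _ => v j) ω := by
    intro ω
    simp [Set.indicator_apply]
  rw [e1]
  simp_rw [e2]
  rw [integral_finsetSum]
  · simp only [Matrix.mulVec, dotProduct, Finset.mul_sum]
    refine Finset.sum_congr rfl fun j _ => ?_
    have hj : MeasurableSet (s (k + 1) ⁻¹' {j}) := hs.1 _ (measurableSet_singleton j)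
    rw [integral_indicator hj, Measure.restrict_restrict hj, setIntegral_const, smul_eq_mul,
      Set.inter_comm, hs.real_path_inter k b j]
    ring
  · intro j _
    exact (integrable_const _).indicator (hs.1 _ (measurableSet_singleton j))

end Chain

/-! ### Products of transition matrices and geometric mixing. -/

/-- The transition matrix of `n` steps from time `k`. -/
def transProd {m : ℕ} (P : ℕ → Matrix (Fin m) (Fin m) ℝ) (k : ℕ) :
    ℕ → Matrix (Fin m) (Fin m) ℝ
  | 0 => 1
  | n + 1 => transProd P k n * P (k + n)

section Mixing

variable {m : ℕ} {P : ℕ → Matrix (Fin m) (Fin m) ℝ}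

theorem transProd_add (k a b : ℕ) :
    transProd P k (a + b) = transProd P k a * transProd P (k + a) b := by
  induction b with
  | zero => simp [transProd]
  | succ b ih => rw [← add_assoc, transProd, transProd, ih, mul_assoc, add_assoc]

theorem transProd_succ_mulVec (k n : ℕ) (v : Fin m → ℝ) :
    (transProd P k (n + 1)).mulVec v = (P k).mulVec ((transProd P (k + 1) n).mulVec v) := by
  rw [add_comm n 1, transProd_add, Matrix.mulVec_mulVec]
  simp [transProd]

theorem transProd_mem (hds : ∀ k, P k ∈ doublyStochastic ℝ (Fin m)) (k n : ℕ) :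
    transProd P k n ∈ doublyStochastic ℝ (Fin m) := by
  induction n with
  | zero => exact one_mem _
  | succ n ih => exact mul_mem ih (hds _)

variable {η : ℝ}

theorem pow_succ_le_transProd (hη : 0 < η) (hds : ∀ k, P k ∈ doublyStochastic ℝ (Fin m))
    {k n : ℕ} {i u v : Fin m} (h : η ^ n ≤ transProd P k n i u) (h' : η ≤ P (k + n) u v) :
    η ^ (n + 1) ≤ transProd P k (n + 1) i v := by
  rw [transProd, Matrix.mul_apply, pow_succ]
  refine (mul_le_mul h h' hη.le (le_trans (by positivity) h)).trans ?_
  exact Finset.single_le_sum (f := fun u => transProd P k n i u * P (k + n) u v)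
    (fun w _ => mul_nonneg (nonneg_of_mem_doublyStochastic (transProd_mem hds k n))
      (nonneg_of_mem_doublyStochastic (hds _))) (Finset.mem_univ u)

theorem pow_le_transProd_mono (hη : 0 < η) (hds : ∀ k, P k ∈ doublyStochastic ℝ (Fin m))
    (hdiag : ∀ k i, η ≤ P k i i) {k n n' : ℕ} (hn : n ≤ n') {i u : Fin m}
    (h : η ^ n ≤ transProd P k n i u) : η ^ n' ≤ transProd P k n' i u := by
  induction n', hn using Nat.le_induction with
  | base => exact h
  | succ n' _ ih => exact pow_succ_le_transProd hη hds ih (hdiag _ _)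

theorem exists_crossing_of_reflTransGen {α : Type*} {r : α → α → Prop} {S : Set α} {i j : α}
    (h : Relation.ReflTransGen r i j) (hi : i ∈ S) (hj : j ∉ S) :
    ∃ u ∈ S, ∃ v ∉ S, r u v := by
  induction h with
  | refl => exact absurd hi hj
  | @tail b c _ hbc ih =>
    by_cases hb : b ∈ S
    · exact ⟨b, hb, c, hj, hbc⟩
    · exact ih hb

/-- Let R n be the states reached from i with weight at least η^n after n steps. Positive diagonals
make R increasing. While R n is proper, strong connectivity of the next window supplies an edge
leaving it, so R gains a state every Q steps and is full after m windows. -/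
theorem pow_le_transProd (hη : 0 < η) (hds : ∀ k, P k ∈ doublyStochastic ℝ (Fin m))
    (hdiag : ∀ k i, 0 < P k i i) (hPη : ∀ k i j, 0 < P k i j → η < P k i j)
    {Q : ℕ} (hconn : StronglyConnectedWithin P Q) (k : ℕ) (i j : Fin m) :
    η ^ (m * Q) ≤ transProd P k (m * Q) i j := by
  classical
  have hd : ∀ k i, η ≤ P k i i := fun k i => (hPη k i i (hdiag k i)).le
  set R : ℕ → Finset (Fin m) := fun n => Finset.univ.filter fun u => η ^ n ≤ transProd P k n i u
    with hR
  have hmem : ∀ n u, u ∈ R n ↔ η ^ n ≤ transProd P k n i u := by intro n u; simp [hR]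
  have hmono : ∀ n n', n ≤ n' → R n ⊆ R n' := fun n n' h u hu =>
    (hmem _ _).2 (pow_le_transProd_mono hη hds hd h ((hmem _ _).1 hu))
  have hi : ∀ n, i ∈ R n := fun n => hmono 0 n (Nat.zero_le n)
    ((hmem _ _).2 (by simp [transProd]))
  have hgrow : ∀ n, R n ≠ Finset.univ → R n ⊂ R (n + Q) := by
    intro n hn
    obtain ⟨w, hw⟩ : ∃ w, w ∉ R n := by
      by_contra! h
      exact hn (Finset.eq_univ_iff_forall.2 h)
    obtain ⟨u, hu, v, hv, l, hl, hl', hpos⟩ :=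
      exists_crossing_of_reflTransGen (S := (R n : Set (Fin m))) (hconn (k + n) i w)
        (by simpa using hi n) (by simpa using hw)
    refine (Finset.ssubset_iff_of_subset (hmono _ _ (Nat.le_add_right n Q))).2
      ⟨v, ?_, by simpa using hv⟩
    obtain ⟨t, rfl⟩ : ∃ t, l = k + t := ⟨l - k, by omega⟩
    -- The crossing edge is used at time k + t with t ≥ n; self-loops keep u until then, and keep v
    -- from then to n + Q.
    have hut : u ∈ R t := hmono n t (by omega) (by simpa using hu)
    exact hmono (t + 1) _ (by omega) ((hmem _ _).2
      (pow_succ_le_transProd hη hds ((hmem _ _).1 hut) (hPη _ _ _ hpos).le))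
  have hcard : ∀ t, min m (t + 1) ≤ (R (t * Q)).card := by
    intro t
    induction t with
    | zero =>
      have := Finset.card_pos.2 ⟨i, hi (0 * Q)⟩
      omega
    | succ t ih =>
      have hle := Finset.card_le_card (hmono (t * Q) ((t + 1) * Q) (by nlinarith))
      by_cases h : R (t * Q) = Finset.univ
      · rw [h, Finset.card_univ, Fintype.card_fin] at hle
        omega
      · have := Finset.card_lt_card (hgrow _ h)
        rw [show t * Q + Q = (t + 1) * Q by ring] at this
        omega
  have hfull : R (m * Q) = Finset.univ := by
    rw [← Finset.card_eq_iff_eq_univ, Fintype.card_fin]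
    have h1 := hcard m
    have h2 := Finset.card_le_univ (R (m * Q))
    rw [Fintype.card_fin] at h2
    omega
  exact (hmem _ _).1 (hfull ▸ Finset.mem_univ j)

/-- A stochastic matrix with entries bounded below contracts vectors of mean zero. -/
theorem abs_mulVec_le_of_le {B : Matrix (Fin m) (Fin m) ℝ} (hB : B ∈ doublyStochastic ℝ (Fin m))
    {θ M : ℝ} (hθ : 0 ≤ θ) (hBθ : ∀ i j, θ ≤ B i j) {v : Fin m → ℝ} (hv : ∑ j, v j = 0)
    (hM : ∀ j, |v j| ≤ M) (i : Fin m) : |B.mulVec v i| ≤ (1 - θ) * M := by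
  -- Subtracting θ from every entry changes nothing on mean-zero vectors, and leaves a nonnegative
  -- matrix with row sums 1 - mθ.
  have e : B.mulVec v i = ∑ j, (B i j - θ) * v j := by
    simp only [Matrix.mulVec, dotProduct, sub_mul, Finset.sum_sub_distrib, ← Finset.mul_sum, hv]
    ring
  rw [e]
  have hM0 : 0 ≤ M := (abs_nonneg _).trans (hM i)
  calc |∑ j, (B i j - θ) * v j| ≤ ∑ j, (B i j - θ) * M := by
        refine (Finset.abs_sum_le_sum_abs _ _).trans (Finset.sum_le_sum fun j _ => ?_)
        rw [abs_mul, abs_of_nonneg (sub_nonneg.2 (hBθ i j))]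
        exact mul_le_mul_of_nonneg_left (hM j) (sub_nonneg.2 (hBθ i j))
    _ = (1 - m * θ) * M := by
        rw [← Finset.sum_mul, Finset.sum_sub_distrib, sum_row_of_mem_doublyStochastic hB]
        simp
    _ ≤ (1 - θ) * M := by
        have : (1 : ℝ) ≤ m := by exact_mod_cast Nat.one_le_iff_ne_zero.2 (by rintro rfl; exact i.elim0)
        gcongr
        nlinarith

/-- Unit column sums enter here: they keep the mean-zero space invariant, so the contraction can be
iterated. -/
theorem sum_transProd_mulVec (hds : ∀ k, P k ∈ doublyStochastic ℝ (Fin m)) (k n : ℕ)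
    {v : Fin m → ℝ} (hv : ∑ j, v j = 0) : ∑ j, (transProd P k n).mulVec v j = 0 := by
  rw [sum_mulVec_of_mem_doublyStochastic (transProd_mem hds k n), hv]

/-- Geometric mixing of the chain. -/
theorem exists_geometric_mixing (hη : 0 < η) (hds : ∀ k, P k ∈ doublyStochastic ℝ (Fin m))
    (hdiag : ∀ k i, 0 < P k i i) (hPη : ∀ k i j, 0 < P k i j → η < P k i j)
    {Q : ℕ} (hQ : 1 ≤ Q) (hconn : StronglyConnectedWithin P Q) :
    ∃ C β : ℝ, 0 ≤ C ∧ 0 ≤ β ∧ β < 1 ∧ ∀ v : Fin m → ℝ, ∑ j, v j = 0 → (∀ j, |v j| ≤ 1) →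
      ∀ k n i, |(transProd P k n).mulVec v i| ≤ C * β ^ n := by
  rcases Nat.eq_zero_or_pos m with rfl | hm
  · exact ⟨0, 0, le_rfl, le_rfl, one_pos, fun _ _ _ _ _ i => i.elim0⟩
  set N := m * Q with hN
  have hN0 : N ≠ 0 := (Nat.mul_pos hm hQ).ne'
  -- The cap 1/2 keeps c = 1 - θ positive, so that c can be inverted below.
  set θ : ℝ := min (η ^ N) (1 / 2) with hθ
  have hθ0 : 0 < θ := lt_min (pow_pos hη N) (by norm_num)
  have hθ1 : θ ≤ 1 / 2 := min_le_right _ _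
  set c : ℝ := 1 - θ with hc
  have hc0 : 0 < c := by linarith
  have hc1 : c < 1 := by linarith
  set β : ℝ := c ^ ((N : ℝ)⁻¹) with hβ
  have hβN : β ^ N = c := Real.rpow_inv_natCast_pow hc0.le hN0
  have hβ0 : 0 < β := Real.rpow_pos_of_pos hc0 _
  have hβ1 : β < 1 := Real.rpow_lt_one hc0.le hc1 (by positivity)
  -- β is the N-th root of the contraction over one block of N steps; the factor c⁻¹ pays for the
  -- incomplete block.
  refine ⟨c⁻¹, β, by positivity, hβ0.le, hβ1, fun v hv hv1 => ?_⟩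
  have hblock : ∀ q k r i, |(transProd P k (q * N + r)).mulVec v i| ≤ c ^ q := by
    intro q
    induction q with
    | zero =>
      intro k r i
      have := abs_mulVec_le_of_le (transProd_mem hds k r) le_rfl
        (fun i j => nonneg_of_mem_doublyStochastic (transProd_mem hds k r)) hv hv1 i
      simpa using this
    | succ q ih =>
      intro k r i
      rw [show (q + 1) * N + r = N + (q * N + r) by ring, transProd_add, ← Matrix.mulVec_mulVec,
        pow_succ']
      exact abs_mulVec_le_of_le (transProd_mem hds k N) hθ0.le
        (fun i j => (min_le_left _ _).trans (pow_le_transProd hη hds hdiag hPη hconn k i j))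
        (sum_transProd_mulVec hds _ _ hv) (fun j => ih _ _ j) i
  intro k n i
  have h1 := hblock (n / N) k (n % N) i
  rw [Nat.div_add_mod' n N] at h1
  refine h1.trans ?_
  have h2 : β ^ n = c ^ (n / N) * β ^ (n % N) := by
    conv_lhs => rw [← Nat.div_add_mod n N, pow_add, pow_mul, hβN]
  have h3 : c ≤ β ^ (n % N) := by
    rw [← hβN]
    exact pow_le_pow_of_le_one hβ0.le hβ1.le (Nat.mod_lt n (Nat.pos_of_ne_zero hN0)).le
  rw [h2, inv_mul_eq_div, le_div_iff₀ hc0]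
  exact mul_le_mul_of_nonneg_left h3 (by positivity)

end Mixing

/-! ### Almost sure convergence along the chain. -/

/-- Weighted sums of a mean-zero function along the chain converge almost surely. The proof uses
the martingale given by the solution of Poisson's equation. -/
theorem IsMarkovChain.ae_exists_tendsto_weighted_sum {Ω : Type*} [MeasurableSpace Ω]
    {Pr : Measure Ω} [IsProbabilityMeasure Pr] {m : ℕ}
    {P : ℕ → Matrix (Fin m) (Fin m) ℝ} {s : ℕ → Ω → Fin m} (hs : IsMarkovChain Pr P s)
    {η : ℝ} (hη : 0 < η) (hds : ∀ k, P k ∈ doublyStochastic ℝ (Fin m))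
    (hdiag : ∀ k i, 0 < P k i i) (hPη : ∀ k i j, 0 < P k i j → η < P k i j)
    {Q : ℕ} (hQ : 1 ≤ Q) (hconn : StronglyConnectedWithin P Q)
    {A : ℕ → ℝ} (hA : Antitone A) (hA0 : ∀ k, 0 ≤ A k) (hAsq : Summable fun k => A k ^ 2)
    {v : Fin m → ℝ} (hv : ∑ j, v j = 0) (hv1 : ∀ j, |v j| ≤ 1) :
    ∀ᵐ ω ∂Pr, ∃ l, Tendsto
      (fun N => ∑ k ∈ Finset.range N, A k * v (s (k + 1) ω)) atTop (𝓝 l) := by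
  obtain ⟨C, β, hC, hβ, hβ1, hmix⟩ := exists_geometric_mixing hη hds hdiag hPη hQ hconn
  -- The sum over n is the expected future weighted sum ∑ A_{k+n} v(s(k+1+n)) given s(k+1) = x.
  -- Mixing makes it converge, and monotonicity of A bounds it by a multiple of A_k.
  set t : ℕ → ℕ → Fin m → ℝ :=
    fun k n x => A (k + n) * (transProd P (k + 1) n).mulVec v x with ht
  have htb : ∀ k n x, |t k n x| ≤ A k * C * β ^ n := by
    intro k n x
    rw [ht]
    simp only [abs_mul, abs_of_nonneg (hA0 _)]
    rw [mul_assoc]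
    exact mul_le_mul (hA (Nat.le_add_right k n)) (hmix v hv hv1 _ _ _) (abs_nonneg _) (hA0 k)
  have hgeo : ∀ k, Summable fun n => A k * C * β ^ n := fun k =>
    (summable_geometric_of_lt_one hβ hβ1).mul_left _
  have hts : ∀ k x, Summable fun n => t k n x := fun k x =>
    Summable.of_norm_bounded (hgeo k) fun n => htb k n x
  set φ : ℕ → Fin m → ℝ := fun k x => ∑' n, t k n x with hφ
  set K : ℝ := C * (1 - β)⁻¹ with hK
  have hφb : ∀ k x, |φ k x| ≤ K * A k := by
    intro k x
    have := tsum_of_norm_bounded (f := fun n => t k n x) (hgeo k).hasSum fun n => htb k n x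
    rw [tsum_mul_left, tsum_geometric_of_lt_one hβ hβ1] at this
    rw [hK]
    simp only [Real.norm_eq_abs] at this
    linarith
  have hpoisson : ∀ k x, φ k x = A k * v x + (P (k + 1)).mulVec (φ (k + 1)) x := by
    intro k x
    rw [hφ]
    simp only
    rw [(hts k x).tsum_eq_zero_add]
    congr 1
    · simp [ht, transProd]
    · simp only [Matrix.mulVec, dotProduct]
      simp_rw [← tsum_mul_left]
      rw [← Summable.tsum_finsetSum fun j _ => (hts (k + 1) j).mul_left _]
      refine tsum_congr fun n => ?_
      simp only [ht, transProd_succ_mulVec]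
      simp only [Matrix.mulVec, dotProduct, Finset.mul_sum]
      rw [show k + 1 + n = k + (n + 1) by ring]
      refine Finset.sum_congr rfl fun j _ => Finset.sum_congr rfl fun l _ => by ring
  have hwb : ∀ k x, |(P k).mulVec (φ k) x| ≤ K * A k := by
    intro k x
    have hsr := sum_row_of_mem_doublyStochastic (hds k) x
    calc |(P k).mulVec (φ k) x| ≤ ∑ j, P k x j * (K * A k) := by
          simp only [Matrix.mulVec, dotProduct]
          refine (Finset.abs_sum_le_sum_abs _ _).trans (Finset.sum_le_sum fun j _ => ?_)
          rw [abs_mul, abs_of_nonneg (nonneg_of_mem_doublyStochastic (hds k))]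
          exact mul_le_mul_of_nonneg_left (hφb k j) (nonneg_of_mem_doublyStochastic (hds k))
      _ = K * A k := by rw [← Finset.sum_mul, hsr, one_mul]
  have hAlim : Tendsto A atTop (𝓝 0) := by
    have := hAsq.tendsto_atTop_zero.sqrt
    simpa [Real.sqrt_sq (hA0 _)] using this
  have hmeas : ∀ k, Measurable[chainFiltration hs.1 (k + 1)] fun ω => φ k (s (k + 1) ω) := fun k =>
    (measurable_of_finite (φ k)).comp (measurable_chainFiltration hs.1 (k + 1))
  have hL : ∀ k, MemLp (fun ω => φ k (s (k + 1) ω)) 2 Pr := fun k =>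
    MemLp.of_bound ((hmeas k).mono ((chainFiltration hs.1).le _) le_rfl).aestronglyMeasurable
      (K * A k) (ae_of_all _ fun ω => hφb k _)
  have hsum : Summable fun k => ∫ ω, φ k (s (k + 1) ω) ^ 2 ∂Pr := by
    refine Summable.of_nonneg_of_le (fun k => integral_nonneg fun ω => sq_nonneg _) (fun k => ?_)
      (hAsq.mul_left (K ^ 2))
    have : ∫ ω, φ k (s (k + 1) ω) ^ 2 ∂Pr ≤ ∫ _, K ^ 2 * A k ^ 2 ∂Pr := by
      refine integral_mono (hL k).integrable_sq (integrable_const _) fun ω => ?_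
      rw [← mul_pow]
      exact sq_le_sq' (abs_le.1 (hφb k _)).1 (abs_le.1 (hφb k _)).2
    simpa using this
  have hmart := ae_exists_tendsto_sum_sub_condExp (chainFiltration hs.1)
    (fun k ω => φ k (s (k + 1) ω)) (fun k => (hmeas k).stronglyMeasurable) hL hsum
  filter_upwards [hmart, ae_all_iff.2 fun k => hs.condExp_eq k (φ k)] with ω ⟨l, hl⟩ hce
  have hw : Tendsto (fun N => (P N).mulVec (φ N) (s N ω)) atTop (𝓝 0) := by
    refine squeeze_zero_norm (fun N => hwb N _) ?_
    simpa using hAlim.const_mul K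
  -- By Poisson's equation, A_k v(s(k+1)) is the martingale difference φ_k(s(k+1)) - (P_k φ_k)(s(k))
  -- plus the increment of -(P_k φ_k)(s(k)), which telescopes.
  have e : ∀ N, ∑ k ∈ Finset.range N, A k * v (s (k + 1) ω) =
      ∑ k ∈ Finset.range N, (φ k (s (k + 1) ω) - (P k).mulVec (φ k) (s k ω)) +
        (P 0).mulVec (φ 0) (s 0 ω) - (P N).mulVec (φ N) (s N ω) := by
    intro N
    induction N with
    | zero => simp
    | succ N ih =>
      rw [Finset.sum_range_succ, Finset.sum_range_succ, ih]
      linarith [hpoisson N (s (N + 1) ω)]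
  refine ⟨l + (P 0).mulVec (φ 0) (s 0 ω) - 0, ?_⟩
  simp_rw [e]
  simp_rw [hce] at hl
  exact (hl.add_const _).sub hw

/-! ### Variational inequality and nonexpansiveness of the projection. -/

section Projection

variable {n : ℕ} {X : Set (EuclideanSpace ℝ (Fin n))}

theorem inner_sub_euclProj_le (hX : IsClosed X) (hc : Convex ℝ X) (hne : X.Nonempty)
    (z : EuclideanSpace ℝ (Fin n)) {y : EuclideanSpace ℝ (Fin n)} (hy : y ∈ X) :
    ⟪z - euclProj X z, y - euclProj X z⟫_ℝ ≤ 0 := by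
  obtain ⟨hp, hmin⟩ := euclProj_spec hX hne z
  refine (norm_eq_iInf_iff_real_inner_le_zero hc hp).1 ?_ y hy
  have : Nonempty X := hne.to_subtype
  refine le_antisymm (le_ciInf fun w => ?_) ?_
  · simpa [dist_eq_norm] using hmin w w.2
  · exact ciInf_le (f := fun w : X => ‖z - w‖) ⟨0, by rintro _ ⟨w, rfl⟩; exact norm_nonneg _⟩
      ⟨_, hp⟩

theorem norm_euclProj_sub_le (hX : IsClosed X) (hc : Convex ℝ X) (hne : X.Nonempty)
    (z w : EuclideanSpace ℝ (Fin n)) : ‖euclProj X z - euclProj X w‖ ≤ ‖z - w‖ := by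
  have h1 := inner_sub_euclProj_le hX hc hne z (euclProj_spec hX hne w).1
  have h2 := inner_sub_euclProj_le hX hc hne w (euclProj_spec hX hne z).1
  set p := euclProj X z
  set q := euclProj X w
  have h3 : ⟪z - w, p - q⟫_ℝ = ‖p - q‖ ^ 2 - ⟪z - p, q - p⟫_ℝ - ⟪w - q, p - q⟫_ℝ := by
    rw [← real_inner_self_eq_norm_sq, ← neg_sub p q, inner_neg_right, sub_neg_eq_add,
      ← inner_add_left, ← inner_sub_left]
    congr 1; abel
  have h4 := real_inner_le_norm (z - w) (p - q)
  rcases eq_or_lt_of_le (norm_nonneg (p - q)) with h | h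
  · rw [← h]; exact norm_nonneg _
  · nlinarith

theorem euclProj_of_mem (hX : IsClosed X) {y : EuclideanSpace ℝ (Fin n)} (hy : y ∈ X) :
    euclProj X y = y := by
  have := (euclProj_spec hX ⟨y, hy⟩ y).2 y hy
  rw [dist_self] at this
  exact (dist_le_zero.1 this).symm

theorem norm_euclProj_sub_le_of_mem (hX : IsClosed X) (hc : Convex ℝ X)
    (z : EuclideanSpace ℝ (Fin n)) {y : EuclideanSpace ℝ (Fin n)} (hy : y ∈ X) :
    ‖euclProj X z - y‖ ≤ ‖z - y‖ := by
  simpa [euclProj_of_mem hX hy] using norm_euclProj_sub_le hX hc ⟨y, hy⟩ z y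

theorem measurable_euclProj (hX : IsClosed X) (hc : Convex ℝ X) (hne : X.Nonempty) :
    Measurable (euclProj X) := by
  have : LipschitzWith 1 (euclProj X) := LipschitzWith.of_dist_le_mul fun z w => by
    simpa [dist_eq_norm] using norm_euclProj_sub_le hX hc hne z w
  exact this.continuous.measurable

end Projection

/-! ### Bounds on subgradients over a compact set. -/

section Subgradient

variable {n : ℕ} {X : Set (EuclideanSpace ℝ (Fin n))}

/-- A unit step from x along γ x raises φ by at least ‖γ x‖, while φ is continuous, hence bounded on
the closed 1-neighbourhood of X. -/
theorem exists_norm_subgradient_le (hX : IsCompact X) {φ : EuclideanSpace ℝ (Fin n) → ℝ}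
    (hφ : ConvexOn ℝ Set.univ φ) {γ : EuclideanSpace ℝ (Fin n) → EuclideanSpace ℝ (Fin n)}
    (hγ : ∀ x ∈ X, IsSubgradientAt φ (γ x) x) : ∃ C, ∀ x ∈ X, ‖γ x‖ ≤ C := by
  have hcont : Continuous φ := continuousOn_univ.1 (hφ.continuousOn isOpen_univ)
  obtain ⟨C, hC⟩ := (hX.cthickening (r := 1)).exists_bound_of_continuousOn hcont.continuousOn
  refine ⟨C + C, fun x hx => ?_⟩
  have hx' : x ∈ Metric.cthickening 1 X := Metric.self_subset_cthickening X hx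
  by_cases h0 : γ x = 0
  · rw [h0, norm_zero]
    linarith [(norm_nonneg _).trans (hC x hx')]
  have hpos : 0 < ‖γ x‖ := norm_pos_iff.2 h0
  set y := x + ‖γ x‖⁻¹ • γ x with hy
  have hyx : y - x = ‖γ x‖⁻¹ • γ x := by rw [hy]; abel
  have hyX : y ∈ Metric.cthickening 1 X := by
    refine Metric.mem_cthickening_of_dist_le y x 1 X hx ?_
    rw [dist_eq_norm, hyx, norm_smul, norm_inv, norm_norm, inv_mul_cancel₀ hpos.ne']
  have h := hγ x hx y
  rw [hyx, inner_smul_right, real_inner_self_eq_norm_sq, pow_two,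
    inv_mul_cancel_left₀ hpos.ne'] at h
  have h1 := abs_le.1 (hC y hyX)
  have h2 := abs_le.1 (hC x hx')
  linarith [h1.2, h2.1]

theorem abs_sub_le_of_subgradient {φ : EuclideanSpace ℝ (Fin n) → ℝ}
    {γ : EuclideanSpace ℝ (Fin n) → EuclideanSpace ℝ (Fin n)}
    (hγ : ∀ x ∈ X, IsSubgradientAt φ (γ x) x) {C : ℝ} (hC : ∀ x ∈ X, ‖γ x‖ ≤ C)
    {x y : EuclideanSpace ℝ (Fin n)} (hx : x ∈ X) (hy : y ∈ X) :
    |φ x - φ y| ≤ C * ‖x - y‖ := by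
  have key : ∀ {x y}, x ∈ X → y ∈ X → φ x - φ y ≤ C * ‖x - y‖ := by
    intro x y hx hy
    have h1 := hγ x hx y
    have h2 := (real_inner_le_norm (γ x) (x - y)).trans
      (mul_le_mul_of_nonneg_right (hC x hx) (norm_nonneg _))
    rw [← neg_sub x y, inner_neg_right] at h1
    linarith
  have h1 := key hx hy
  have h2 := key hy hx
  rw [norm_sub_rev] at h2
  exact abs_le.2 ⟨by linarith, h1⟩

end Subgradient

/-! ### From small objective gap to small distance from the optimal set. -/

section Optimum

variable {n : ℕ} {X : Set (EuclideanSpace ℝ (Fin n))} {φ : EuclideanSpace ℝ (Fin n) → ℝ}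

theorem optimalValue_eq {y : EuclideanSpace ℝ (Fin n)} (hy : y ∈ optimalSet φ X) :
    optimalValue φ X = φ y := by
  refine IsLeast.csInf_eq ⟨⟨y, hy.1, rfl⟩, ?_⟩
  rintro _ ⟨z, hz, rfl⟩
  exact hy.2 z hz

/-- On the compact set of points of X at distance at least δ from the optimal set, φ attains a
minimum strictly above φ y; the excess is δ'. -/
theorem exists_gap_of_infDist (hX : IsCompact X) (hφ : Continuous φ)
    {y : EuclideanSpace ℝ (Fin n)} (hy : y ∈ optimalSet φ X) {δ : ℝ} (hδ : 0 < δ) :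
    ∃ δ' > 0, ∀ x ∈ X, φ x - φ y < δ' → Metric.infDist x (optimalSet φ X) < δ := by
  set S := X ∩ {x | δ ≤ Metric.infDist x (optimalSet φ X)} with hS
  have hSc : IsCompact S :=
    hX.inter_right (isClosed_le continuous_const (Metric.continuous_infDist_pt _))
  rcases S.eq_empty_or_nonempty with h | h
  · refine ⟨1, one_pos, fun x hx _ => ?_⟩
    by_contra! hc
    have : x ∈ S := ⟨hx, hc⟩
    rw [h] at this
    exact this
  · obtain ⟨z, hz, hmin⟩ := hSc.exists_isMinOn h hφ.continuousOn
    refine ⟨φ z - φ y, ?_, fun x hx hlt => ?_⟩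
    · refine sub_pos.2 (lt_of_le_of_ne (hy.2 z hz.1) fun heq => ?_)
      have hzo : z ∈ optimalSet φ X := ⟨hz.1, fun w hw => heq ▸ hy.2 w hw⟩
      have : δ ≤ Metric.infDist z (optimalSet φ X) := hz.2
      rw [Metric.infDist_zero_of_mem hzo] at this
      linarith
    · by_contra! hc
      have := isMinOn_iff.1 hmin x ⟨hx, hc⟩
      linarith

/-- A sequence bounded below by `c` which is infinitely often arbitrarily close to `c` has
lower limit `c`. -/
theorem liminf_eq_of_frequently_lt {u : ℕ → ℝ} {c : ℝ} (hc : ∀ k, c ≤ u k)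
    (hf : ∀ δ > 0, ∃ᶠ k in atTop, u k < c + δ) : liminf u atTop = c := by
  have hb : IsBoundedUnder (· ≥ ·) atTop u := isBoundedUnder_of ⟨c, hc⟩
  have hcob : IsCoboundedUnder (· ≥ ·) atTop u :=
    IsCoboundedUnder.of_frequently_le ((hf 1 one_pos).mono fun _ h => h.le)
  refine le_antisymm (le_of_forall_pos_le_add fun δ hδ => ?_)
    (le_liminf_of_le hcob (Eventually.of_forall hc))
  exact liminf_le_of_frequently_le ((hf δ hδ).mono fun _ h => h.le) hb

end Optimum

/-! ### Weighted sums of real sequences. -/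

section Deterministic

theorem exists_sum_le_add_sum {a b : ℕ → ℝ} (h : ∀ᶠ k in atTop, a k ≤ b k) :
    ∃ B, ∀ N, ∑ k ∈ Finset.range N, a k ≤ B + ∑ k ∈ Finset.range N, b k := by
  obtain ⟨N₀, hN₀⟩ := eventually_atTop.1 h
  refine ⟨∑ k ∈ Finset.range N₀, |a k - b k|, fun N => ?_⟩
  rw [← sub_le_iff_le_add, ← Finset.sum_sub_distrib]
  calc ∑ k ∈ Finset.range N, (a k - b k)
      ≤ ∑ k ∈ Finset.range N, if k ∈ Finset.range N₀ then |a k - b k| else 0 := by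
        refine Finset.sum_le_sum fun k _ => ?_
        split_ifs with hk
        · exact le_abs_self _
        · exact sub_nonpos.2 (hN₀ k (by simpa using hk))
    _ = ∑ k ∈ Finset.range N ∩ Finset.range N₀, |a k - b k| := by
        rw [Finset.sum_ite_mem]
    _ ≤ ∑ k ∈ Finset.range N₀, |a k - b k| :=
        Finset.sum_le_sum_of_subset_of_nonneg Finset.inter_subset_right
          fun _ _ _ => abs_nonneg _

/-- If c k ≥ δ eventually, the left side grows like δ ∑ A, whereas u → 0 lets the right side grow at
most like (δ/2) ∑ A, contradicting divergence. -/
theorem frequently_lt_of_weighted_sum_le {A c w u : ℕ → ℝ} (hA : ∀ k, 0 ≤ A k)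
    (hAdiv : Tendsto (fun N => ∑ k ∈ Finset.range N, A k) atTop atTop) (hw : ∀ k, 0 ≤ w k)
    {K B : ℝ} (hK : 0 ≤ K)
    (hwK : ∀ N, ∑ k ∈ Finset.range N, A k * w k ≤ K * (1 + ∑ k ∈ Finset.range N, A k))
    (hu : Tendsto u atTop (𝓝 0))
    (h : ∀ N, ∑ k ∈ Finset.range N, A k * c k ≤
      B + ∑ k ∈ Finset.range N, u k * (A k * w k)) {δ : ℝ} (hδ : 0 < δ) :
    ∃ᶠ k in atTop, c k < δ := by
  by_contra hcon
  have hev : ∀ᶠ k in atTop, δ ≤ c k := by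
    simpa [Filter.Frequently] using hcon
  -- Chosen so that e * K ≤ δ / 2; the + 1 covers K = 0.
  set e : ℝ := δ / (2 * (K + 1)) with he
  have he0 : 0 < e := by positivity
  have heK : e * K ≤ δ / 2 := by
    rw [he, div_mul_eq_mul_div, div_le_div_iff₀ (by positivity) (by positivity)]
    nlinarith
  obtain ⟨B₁, hB₁⟩ := exists_sum_le_add_sum (a := fun k => A k * δ) (b := fun k => A k * c k)
    (hev.mono fun k hk => mul_le_mul_of_nonneg_left hk (hA k))
  obtain ⟨B₂, hB₂⟩ := exists_sum_le_add_sum (a := fun k => u k * (A k * w k))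
    (b := fun k => e * (A k * w k))
    ((hu.eventually_lt_const he0).mono fun k hk =>
      mul_le_mul_of_nonneg_right hk.le (mul_nonneg (hA k) (hw k)))
  obtain ⟨N, hN⟩ := (hAdiv.eventually_gt_atTop ((B₁ + B + B₂ + δ / 2) / (δ / 2))).exists
  rw [div_lt_iff₀ (by positivity)] at hN
  have h1 := hB₁ N
  have h2 := hB₂ N
  rw [← Finset.mul_sum] at h2
  rw [← Finset.sum_mul] at h1
  have h3 := mul_le_mul_of_nonneg_left (hwK N) he0.le
  have hS : 0 ≤ ∑ k ∈ Finset.range N, A k := Finset.sum_nonneg fun k _ => hA k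
  have h4 : e * (K * (1 + ∑ k ∈ Finset.range N, A k)) ≤
      δ / 2 * (1 + ∑ k ∈ Finset.range N, A k) := by
    rw [← mul_assoc]
    exact mul_le_mul_of_nonneg_right heK (by linarith)
  linarith [h N]

/-- Summation by parts against a convergent series. -/
theorem exists_abs_sum_mul_le {d h r : ℕ → ℝ} {l H : ℝ}
    (hd : Tendsto (fun N => ∑ k ∈ Finset.range N, d k) atTop (𝓝 l)) (hH : ∀ k, |h k| ≤ H)
    (hr : ∀ k, |h (k + 1) - h k| ≤ r k) :
    ∃ (B : ℝ) (u : ℕ → ℝ), Tendsto u atTop (𝓝 0) ∧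
      ∀ N, |∑ k ∈ Finset.range N, d k * h k| ≤ B + ∑ k ∈ Finset.range N, u k * r k := by
  -- Centring the partial sums at their limit makes the Abel weights tend to zero, which turns the
  -- increment sum into an o(∑ r) term.
  set V : ℕ → ℝ := fun N => ∑ k ∈ Finset.range N, d k - l with hV
  have hV0 : Tendsto V atTop (𝓝 0) := by simpa [hV] using hd.sub_const l
  obtain ⟨R, hR⟩ := (Metric.isBounded_range_of_tendsto V hV0).exists_norm_le
  have hVR : ∀ k, |V k| ≤ R := fun k => hR _ ⟨k, rfl⟩
  have habel : ∀ N, ∑ k ∈ Finset.range N, d k * h k =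
      V N * h N - V 0 * h 0 - ∑ k ∈ Finset.range N, V (k + 1) * (h (k + 1) - h k) := by
    intro N
    induction N with
    | zero => simp
    | succ N ih =>
      have : V (N + 1) = V N + d N := by simp only [hV, Finset.sum_range_succ]; ring
      rw [Finset.sum_range_succ, Finset.sum_range_succ, ih, this]
      ring
  have hVh : ∀ k, |V k * h k| ≤ R * H := fun k => by
    rw [abs_mul]
    exact mul_le_mul (hVR k) (hH k) (abs_nonneg _) ((abs_nonneg _).trans (hVR k))
  refine ⟨R * H + R * H, fun k => |V (k + 1)|, ?_, fun N => ?_⟩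
  · simpa using (hV0.comp (tendsto_add_atTop_nat 1)).abs
  · rw [habel]
    refine (abs_sub _ _).trans (add_le_add ((abs_sub _ _).trans
      (add_le_add (hVh N) (hVh 0))) ?_)
    refine (Finset.abs_sum_le_sum_abs _ _).trans (Finset.sum_le_sum fun k _ => ?_)
    rw [abs_mul]
    exact mul_le_mul_of_nonneg_left (hr k) (abs_nonneg _)

end Deterministic

/-! ### The pathwise argument. -/

/-- Pathwise convergence of the projected incremental subgradient method: it suffices that the
agents are visited with asymptotically uniform weighted frequency and that the noise is
summable in the appropriate senses. -/
theorem frequently_netObjective_sub_lt {n m : ℕ} {X : Set (EuclideanSpace ℝ (Fin n))}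
    (hX : IsClosed X) (hc : Convex ℝ X) (hb : Bornology.IsBounded X)
    {f : Fin m → EuclideanSpace ℝ (Fin n) → ℝ}
    {g : Fin m → EuclideanSpace ℝ (Fin n) → EuclideanSpace ℝ (Fin n)}
    (hg : ∀ i, ∀ x ∈ X, IsSubgradientAt (f i) (g i x) x)
    {C : ℝ} (hC : ∀ i, ∀ x ∈ X, ‖g i x‖ ≤ C)
    {A : ℕ → ℝ} (hA : ∀ k, 0 ≤ A k)
    (hAdiv : Tendsto (fun N => ∑ k ∈ Finset.range N, A k) atTop atTop)
    (hAsq : Summable fun k => A k ^ 2) {σ : ℕ → Fin m} {x e : ℕ → EuclideanSpace ℝ (Fin n)}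
    (hxX : ∀ k, x k ∈ X)
    (hx : ∀ k, x (k + 1) = euclProj X (x k - A k • (g (σ k) (x k) + e k)))
    {y : EuclideanSpace ℝ (Fin n)} (hy : y ∈ X)
    (hσ : ∀ i, ∃ l, Tendsto
      (fun N => ∑ k ∈ Finset.range N, A k * ((if σ k = i then 1 else 0) - (m : ℝ)⁻¹))
      atTop (𝓝 l))
    (hinner : ∃ B, ∀ N, -B ≤ ∑ k ∈ Finset.range N, A k * ⟪e k, x k - y⟫_ℝ)
    (hesq : Summable fun k => A k ^ 2 * ‖e k‖ ^ 2)
    (hnorm : ∃ K, 0 ≤ K ∧ ∀ N, ∑ k ∈ Finset.range N, A k * ‖e k‖ ≤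
      K * (1 + ∑ k ∈ Finset.range N, A k))
    {δ : ℝ} (hδ : 0 < δ) :
    ∃ᶠ k in atTop, netObjective f (x k) - netObjective f y < δ := by
  have hm : 0 < m := (Nat.zero_le _).trans_lt (σ 0).2
  have hm' : (0 : ℝ) < m := by exact_mod_cast hm
  have hC0 : 0 ≤ C := (norm_nonneg _).trans (hC (σ 0) y hy)
  set w : ℕ → ℝ := fun k => C + ‖e k‖ with hw
  have hstep : ∀ k, ‖x (k + 1) - x k‖ ≤ A k * w k := by
    intro k
    rw [hx]
    refine (norm_euclProj_sub_le_of_mem hX hc _ (hxX k)).trans ?_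
    rw [sub_sub_cancel_left, norm_neg, norm_smul, Real.norm_of_nonneg (hA k)]
    exact mul_le_mul_of_nonneg_left
      ((norm_add_le _ _).trans (add_le_add (hC _ _ (hxX k)) le_rfl)) (hA k)
  have hlip : ∀ i {x z}, x ∈ X → z ∈ X → |f i x - f i z| ≤ C * ‖x - z‖ := fun i _ _ hx hz =>
    abs_sub_le_of_subgradient (hg i) (hC i) hx hz
  have hh : ∀ i k, |f i (x k) - f i y| ≤ C * Metric.diam X := fun i k =>
    (hlip i (hxX k) hy).trans (mul_le_mul_of_nonneg_left
      (by rw [← dist_eq_norm]; exact Metric.dist_le_diam_of_mem hb (hxX k) hy) hC0)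
  have hhr : ∀ i k, |(f i (x (k + 1)) - f i y) - (f i (x k) - f i y)| ≤ C * (A k * w k) := by
    intro i k
    rw [sub_sub_sub_cancel_right]
    exact (hlip i (hxX _) (hxX k)).trans (mul_le_mul_of_nonneg_left (hstep k) hC0)
  choose l hl using hσ
  -- Summation by parts, agent by agent: the frequency series converges, and f_i(x_k) - f_i(y) is
  -- bounded with increments at most C A_k w_k.
  choose Bf u hu hBu using fun i => exists_abs_sum_mul_le (hl i) (hh i) (hhr i)
  obtain ⟨B₁, hB₁⟩ := hinner
  obtain ⟨K, hK, hKw⟩ := hnorm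
  have hrec : ∀ k, ‖x (k + 1) - y‖ ^ 2 ≤ ‖x k - y‖ ^ 2
      - 2 * (A k * (f (σ k) (x k) - f (σ k) y)) - 2 * (A k * ⟪e k, x k - y⟫_ℝ)
      + (2 * C ^ 2 * A k ^ 2 + 2 * (A k ^ 2 * ‖e k‖ ^ 2)) := by
    intro k
    have h1 : ‖x (k + 1) - y‖ ^ 2 ≤ ‖(x k - y) - A k • (g (σ k) (x k) + e k)‖ ^ 2 := by
      rw [hx, sub_right_comm (x k) y]
      exact pow_le_pow_left₀ (norm_nonneg _) (norm_euclProj_sub_le_of_mem hX hc _ hy) 2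
    rw [norm_sub_sq_real (x k - y), inner_smul_right, inner_add_right, norm_smul, mul_pow,
      Real.norm_eq_abs, sq_abs] at h1
    have h2 := hg (σ k) (x k) (hxX k) y
    rw [← neg_sub (x k) y, inner_neg_right, real_inner_comm] at h2
    rw [real_inner_comm (x k - y) (e k)]
    have h3 : ‖g (σ k) (x k) + e k‖ ^ 2 ≤ 2 * C ^ 2 + 2 * ‖e k‖ ^ 2 := by
      have h4 := (norm_add_le (g (σ k) (x k)) (e k)).trans
        (add_le_add (hC (σ k) _ (hxX k)) le_rfl)
      have h5 := pow_le_pow_left₀ (norm_nonneg _) h4 2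
      nlinarith [sq_nonneg (C - ‖e k‖)]
    have h6 := mul_le_mul_of_nonneg_left h3 (sq_nonneg (A k))
    have h7 := mul_le_mul_of_nonneg_left h2 (hA k)
    nlinarith
  have hsum : ∀ N, ‖x N - y‖ ^ 2 ≤ ‖x 0 - y‖ ^ 2
      - 2 * ∑ k ∈ Finset.range N, A k * (f (σ k) (x k) - f (σ k) y)
      - 2 * ∑ k ∈ Finset.range N, A k * ⟪e k, x k - y⟫_ℝ
      + (2 * C ^ 2 * ∑ k ∈ Finset.range N, A k ^ 2
        + 2 * ∑ k ∈ Finset.range N, A k ^ 2 * ‖e k‖ ^ 2) := by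
    intro N
    induction N with
    | zero => simp
    | succ N ih =>
      simp only [Finset.sum_range_succ]
      linarith [hrec N]
  -- The sampled agent's term is the uniform average over agents plus centred visit indicators.
  have hdecomp : ∀ k, A k * (f (σ k) (x k) - f (σ k) y) =
      (m : ℝ)⁻¹ * (A k * (netObjective f (x k) - netObjective f y)) +
        ∑ i, A k * ((if σ k = i then 1 else 0) - (m : ℝ)⁻¹) * (f i (x k) - f i y) := by
    intro k
    simp only [netObjective, mul_sub, sub_mul, Finset.sum_sub_distrib, mul_ite, ite_mul,
      mul_zero, zero_mul, mul_one, Finset.sum_ite_eq, Finset.mem_univ, if_true, Finset.mul_sum]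
    have : ∀ z, ∑ i, (m : ℝ)⁻¹ * (A k * f i z) = ∑ i, A k * (m : ℝ)⁻¹ * f i z := fun z =>
      Finset.sum_congr rfl fun i _ => by ring
    rw [this, this]
    ring
  set T₁ : ℝ := ∑' k, A k ^ 2
  set T₂ : ℝ := ∑' k, A k ^ 2 * ‖e k‖ ^ 2
  set B : ℝ := m * (‖x 0 - y‖ ^ 2 / 2 + B₁ + C ^ 2 * T₁ + T₂ + ∑ i, Bf i) with hB
  refine frequently_lt_of_weighted_sum_le (w := w) (u := fun k => m * (C * ∑ i, u i k)) (B := B)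
    (K := C + K) hA hAdiv (fun k => add_nonneg hC0 (norm_nonneg _)) (by positivity) ?_ ?_ ?_ hδ
  · intro N
    simp only [hw, mul_add, Finset.sum_add_distrib, ← Finset.sum_mul]
    have := hKw N
    nlinarith
  · simpa using (((tendsto_finsetSum Finset.univ fun i _ => hu i).const_mul C).const_mul (m : ℝ))
  · intro N
    have h1 := hsum N
    have h2 := hAsq.sum_le_tsum (Finset.range N) fun k _ => sq_nonneg (A k)
    have h3 := hesq.sum_le_tsum (Finset.range N) fun k _ => by positivity
    have h4 := mul_le_mul_of_nonneg_left h2 (sq_nonneg C)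
    simp_rw [hdecomp] at h1
    rw [Finset.sum_add_distrib, ← Finset.mul_sum, Finset.sum_comm] at h1
    have h5 : -∑ i, ∑ k ∈ Finset.range N,
        A k * ((if σ k = i then 1 else 0) - (m : ℝ)⁻¹) * (f i (x k) - f i y) ≤
        ∑ i, Bf i + ∑ i, ∑ k ∈ Finset.range N, u i k * (C * (A k * w k)) := by
      rw [← Finset.sum_neg_distrib, ← Finset.sum_add_distrib]
      exact Finset.sum_le_sum fun i _ => (neg_le_abs _).trans (hBu i N)
    have h6 : ∑ k ∈ Finset.range N, m * (C * ∑ i, u i k) * (A k * w k) =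
        m * ∑ i, ∑ k ∈ Finset.range N, u i k * (C * (A k * w k)) := by
      rw [Finset.sum_comm, Finset.mul_sum]
      refine Finset.sum_congr rfl fun k _ => ?_
      rw [← Finset.sum_mul]
      ring
    have h7 : (m : ℝ)⁻¹ * ∑ k ∈ Finset.range N,
        A k * (netObjective f (x k) - netObjective f y) ≤
        ‖x 0 - y‖ ^ 2 / 2 + B₁ + C ^ 2 * T₁ + T₂ + ∑ i, Bf i +
          ∑ i, ∑ k ∈ Finset.range N, u i k * (C * (A k * w k)) := by
      nlinarith [hB₁ N, sq_nonneg ‖x N - y‖]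
    rw [inv_mul_le_iff₀ hm'] at h7
    rw [h6, hB]
    linarith

/-! ### The step sizes: monotone, square summable, divergent sum. -/

section StepSize

variable {a p : ℝ}

theorem stepSize_nonneg (ha : 0 < a) (k : ℕ) : 0 ≤ stepSize a p k :=
  div_nonneg ha.le (Real.rpow_nonneg (Nat.cast_nonneg k) p)

theorem antitone_stepSize_succ (ha : 0 < a) (hp : 0 ≤ p) :
    Antitone fun k => stepSize a p (k + 1) := by
  intro k l hkl
  refine div_le_div_of_nonneg_left ha.le (Real.rpow_pos_of_pos (by positivity) p) ?_
  exact Real.rpow_le_rpow (by positivity) (by exact_mod_cast Nat.succ_le_succ hkl) hp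

theorem summable_stepSize_succ_sq (hp : 1 / 2 < p) :
    Summable fun k => stepSize a p (k + 1) ^ 2 := by
  have h : Summable fun k : ℕ => a ^ 2 * (1 / (k : ℝ) ^ (2 * p)) :=
    (Real.summable_one_div_nat_rpow.2 (by linarith)).mul_left _
  refine ((summable_nat_add_iff 1).2 h).congr fun k => ?_
  rw [stepSize, div_pow, ← Real.rpow_natCast (((k + 1 : ℕ) : ℝ) ^ p) 2,
    ← Real.rpow_mul (Nat.cast_nonneg _), mul_one_div, mul_comm 2 p]
  norm_num

theorem tendsto_sum_stepSize_succ (ha : 0 < a) (hp : p ≤ 1) :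
    Tendsto (fun N => ∑ k ∈ Finset.range N, stepSize a p (k + 1)) atTop atTop := by
  rw [← not_summable_iff_tendsto_nat_atTop_of_nonneg fun k => stepSize_nonneg ha (k + 1)]
  intro h
  have h1 : Summable fun k : ℕ => stepSize a p k :=
    (summable_nat_add_iff (f := fun k => stepSize a p k) 1).1 h
  have h2 := h1.mul_left a⁻¹
  refine absurd (Real.summable_one_div_nat_rpow.1 (h2.congr fun k => ?_)) (not_lt.2 hp)
  rw [stepSize]
  field_simp

end StepSize

/-! ### Almost sure control of the noise. -/

theorem ae_summable_of_summable_integral {Ω : Type*} [MeasurableSpace Ω] {Pr : Measure Ω}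
    {F : ℕ → Ω → ℝ} (hF : ∀ k ω, 0 ≤ F k ω) (hi : ∀ k, Integrable (F k) Pr)
    (hs : Summable fun k => ∫ ω, F k ω ∂Pr) : ∀ᵐ ω ∂Pr, Summable fun k => F k ω := by
  have h1 : ∫⁻ ω, ∑' k, ENNReal.ofReal (F k ω) ∂Pr ≠ ⊤ := by
    rw [lintegral_tsum fun k => (hi k).aestronglyMeasurable.aemeasurable.ennreal_ofReal]
    simp_rw [← ofReal_integral_eq_lintegral_ofReal (hi _) (ae_of_all _ (hF _))]
    rw [← ENNReal.ofReal_tsum_of_nonneg (fun k => integral_nonneg (hF k)) hs]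
    exact ENNReal.ofReal_ne_top
  have h2 := ae_lt_top' (AEMeasurable.tsum fun k =>
    (hi k).aestronglyMeasurable.aemeasurable.ennreal_ofReal) h1
  filter_upwards [h2] with ω hω
  exact (ENNReal.summable_toReal hω.ne).congr fun k => ENNReal.toReal_ofReal (hF k ω)

section Noise

variable {Ω : Type*} {m0 : MeasurableSpace Ω} {Pr : Measure Ω} [IsProbabilityMeasure Pr] {n : ℕ}
  {𝒢 : Filtration ℕ m0} {e : ℕ → Ω → EuclideanSpace ℝ (Fin n)} {A : ℕ → ℝ} {V : ℝ}

theorem integral_norm_sq_le (hV : ∀ k, ∀ᵐ ω ∂Pr, (Pr[fun ω' => ‖e k ω'‖ ^ 2 | 𝒢 k]) ω ≤ V)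
    (k : ℕ) : ∫ ω, ‖e k ω‖ ^ 2 ∂Pr ≤ V := by
  rw [← integral_condExp (𝒢.le k)]
  simpa using integral_mono_ae integrable_condExp (integrable_const V) (hV k)

theorem summable_integral_sq_of_le
    (hL : ∀ k, MemLp (e k) 2 Pr)
    (hV : ∀ k, ∀ᵐ ω ∂Pr, (Pr[fun ω' => ‖e k ω'‖ ^ 2 | 𝒢 k]) ω ≤ V)
    (hAsq : Summable fun k => A k ^ 2) {Z : ℕ → Ω → ℝ} {D : ℝ}
    (hZ : ∀ k ω, |Z k ω| ≤ D * (|A k| * ‖e k ω‖)) :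
    Summable fun k => ∫ ω, Z k ω ^ 2 ∂Pr := by
  refine Summable.of_nonneg_of_le (fun k => integral_nonneg fun ω => sq_nonneg _) (fun k => ?_)
    (hAsq.mul_left (D ^ 2 * V))
  have h1 : ∫ ω, Z k ω ^ 2 ∂Pr ≤ ∫ ω, D ^ 2 * A k ^ 2 * ‖e k ω‖ ^ 2 ∂Pr := by
    refine integral_mono_of_nonneg (ae_of_all _ fun ω => sq_nonneg _)
      ((hL k).norm.integrable_sq.const_mul _) (ae_of_all _ fun ω => ?_)
    have := pow_le_pow_left₀ (abs_nonneg _) (hZ k ω) 2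
    simpa only [mul_pow, sq_abs, mul_assoc] using this
  rw [integral_const_mul] at h1
  have h2 := mul_le_mul_of_nonneg_left (integral_norm_sq_le hV k)
    (show 0 ≤ D ^ 2 * A k ^ 2 by positivity)
  linarith

theorem ae_summable_sq_noise (hL : ∀ k, MemLp (e k) 2 Pr)
    (hV : ∀ k, ∀ᵐ ω ∂Pr, (Pr[fun ω' => ‖e k ω'‖ ^ 2 | 𝒢 k]) ω ≤ V)
    (hAsq : Summable fun k => A k ^ 2) :
    ∀ᵐ ω ∂Pr, Summable fun k => A k ^ 2 * ‖e k ω‖ ^ 2 := by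
  refine ae_summable_of_summable_integral (fun k ω => by positivity)
    (fun k => (hL k).norm.integrable_sq.const_mul _) ?_
  have := summable_integral_sq_of_le (Z := fun k ω => A k * ‖e k ω‖) (D := 1) hL hV hAsq
    (fun k ω => by rw [abs_mul, abs_norm, one_mul])
  simpa only [mul_pow] using this

/-- The noise need not vanish, so only growth of order ∑ A_k is available: the compensated sum
converges, and each compensator is at most (1 + V) A_k. -/
theorem ae_exists_sum_norm_noise_le (he : ∀ k, Measurable[𝒢 (k + 1)] (e k))
    (hL : ∀ k, MemLp (e k) 2 Pr)
    (hV : ∀ k, ∀ᵐ ω ∂Pr, (Pr[fun ω' => ‖e k ω'‖ ^ 2 | 𝒢 k]) ω ≤ V)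
    (hA : ∀ k, 0 ≤ A k) (hAsq : Summable fun k => A k ^ 2) :
    ∀ᵐ ω ∂Pr, ∃ K, 0 ≤ K ∧ ∀ N, ∑ k ∈ Finset.range N, A k * ‖e k ω‖ ≤
      K * (1 + ∑ k ∈ Finset.range N, A k) := by
  set W : ℕ → Ω → ℝ := fun k ω => A k * ‖e k ω‖ with hW
  have hWL : ∀ k, MemLp (W k) 2 Pr := fun k => (hL k).norm.const_mul (A k)
  have hconv := ae_exists_tendsto_sum_sub_condExp 𝒢 W
    (fun k => (((measurable_norm.comp (he k)).const_mul (A k))).stronglyMeasurable) hWL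
    (summable_integral_sq_of_le (D := 1) hL hV hAsq
      fun k ω => by rw [hW, abs_mul, abs_norm, one_mul])
  have hce : ∀ k, ∀ᵐ ω ∂Pr, (Pr[W k | 𝒢 k]) ω ≤ (1 + V) * A k := by
    intro k
    have hi := (hL k).norm.integrable_sq
    -- From t ≤ 1 + t², to use the conditional second moment.
    have h1 : W k ≤ᵐ[Pr] (fun _ => A k) + A k • fun ω => ‖e k ω‖ ^ 2 := by
      refine ae_of_all _ fun ω => ?_
      simp only [hW, Pi.add_apply, Pi.smul_apply, smul_eq_mul]
      nlinarith [mul_nonneg (hA k) (sq_nonneg (‖e k ω‖ - 1)), mul_nonneg (hA k) (sq_nonneg ‖e k ω‖),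
        hA k]
    have h2 := condExp_mono (m := 𝒢 k) ((hWL k).integrable one_le_two)
      ((integrable_const (A k)).add (hi.smul (A k))) h1
    have h3 := condExp_add (integrable_const (A k)) (hi.smul (A k)) (𝒢 k)
    have h4 := condExp_smul (μ := Pr) (A k) (fun ω => ‖e k ω‖ ^ 2) (𝒢 k)
    filter_upwards [h2, h3, h4, hV k] with ω w2 w3 w4 w5
    rw [w3, Pi.add_apply, w4, condExp_const (𝒢.le k), Pi.smul_apply, smul_eq_mul] at w2
    nlinarith [mul_le_mul_of_nonneg_left w5 (hA k)]
  filter_upwards [hconv, ae_all_iff.2 hce] with ω ⟨l, hl⟩ hce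
  obtain ⟨R, hR⟩ := (Metric.isBounded_range_of_tendsto _ hl).exists_norm_le
  refine ⟨max (1 + V) 0 + |R|, by positivity, fun N => ?_⟩
  have h1 := (le_abs_self _).trans (hR _ ⟨N, rfl⟩)
  simp only [Finset.sum_sub_distrib] at h1
  have h2 : ∑ k ∈ Finset.range N, (Pr[W k | 𝒢 k]) ω ≤
      (1 + V) * ∑ k ∈ Finset.range N, A k := by
    rw [Finset.mul_sum]
    exact Finset.sum_le_sum fun k _ => hce k
  have hS : 0 ≤ ∑ k ∈ Finset.range N, A k := Finset.sum_nonneg fun k _ => hA k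
  have h3 := mul_le_mul_of_nonneg_right (le_max_left (1 + V) 0) hS
  have h4 : 0 ≤ max (1 + V) 0 := le_max_right _ _
  nlinarith [le_abs_self R, mul_nonneg (abs_nonneg R) hS]

/-- As z k is known at time k, it leaves the conditional expectation, so the compensator is at most
D A_k μ_k in absolute value, which is summable; the compensated sum converges. -/
theorem ae_exists_le_sum_inner_noise (he : ∀ k, Measurable[𝒢 (k + 1)] (e k))
    (hL : ∀ k, MemLp (e k) 2 Pr)
    (hV : ∀ k, ∀ᵐ ω ∂Pr, (Pr[fun ω' => ‖e k ω'‖ ^ 2 | 𝒢 k]) ω ≤ V)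
    {μ : ℕ → ℝ} (hμ : ∀ k, ∀ᵐ ω ∂Pr, ‖(Pr[e k | 𝒢 k]) ω‖ ≤ μ k)
    (hA : ∀ k, 0 ≤ A k) (hAsq : Summable fun k => A k ^ 2) (hAμ : Summable fun k => A k * μ k)
    {z : ℕ → Ω → EuclideanSpace ℝ (Fin n)} (hz : ∀ k, Measurable[𝒢 k] (z k)) {D : ℝ}
    (hD : ∀ k ω, ‖z k ω‖ ≤ D) :
    ∀ᵐ ω ∂Pr, ∃ B, ∀ N, -B ≤ ∑ k ∈ Finset.range N, A k * ⟪e k ω, z k ω⟫_ℝ := by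
  set Z : ℕ → Ω → ℝ := fun k ω => A k * ⟪e k ω, z k ω⟫_ℝ with hZ
  have hinner : ∀ k (v : EuclideanSpace ℝ (Fin n)) ω, |⟪v, z k ω⟫_ℝ| ≤ D * ‖v‖ := fun k v ω => by
    rw [mul_comm]
    exact (abs_real_inner_le_norm _ _).trans
      (mul_le_mul_of_nonneg_left (hD k ω) (norm_nonneg _))
  have hZb : ∀ k ω, |Z k ω| ≤ D * (|A k| * ‖e k ω‖) := fun k ω => by
    rw [hZ, abs_mul]
    have := mul_le_mul_of_nonneg_left (hinner k (e k ω) ω) (abs_nonneg (A k))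
    linarith
  have hZm : ∀ k, Measurable[𝒢 (k + 1)] (Z k) := fun k =>
    ((he k).inner ((hz k).mono (𝒢.mono (Nat.le_succ k)) le_rfl)).const_mul _
  have him : ∀ k, AEStronglyMeasurable (fun ω => ⟪e k ω, z k ω⟫_ℝ) Pr := fun k =>
    (((he k).inner ((hz k).mono (𝒢.mono (Nat.le_succ k)) le_rfl)).mono (𝒢.le _)
      le_rfl).aestronglyMeasurable
  have hIL : ∀ k, MemLp (fun ω => ⟪e k ω, z k ω⟫_ℝ) 2 Pr := fun k =>
    (hL k).of_le_mul (him k) (ae_of_all _ fun ω => hinner k _ ω)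
  have hZL : ∀ k, MemLp (Z k) 2 Pr := fun k => (hIL k).const_mul (A k)
  have hconv := ae_exists_tendsto_sum_sub_condExp 𝒢 Z (fun k => (hZm k).stronglyMeasurable) hZL
    (summable_integral_sq_of_le hL hV hAsq hZb)
  have hce : ∀ k, ∀ᵐ ω ∂Pr, |(Pr[Z k | 𝒢 k]) ω| ≤ D * (A k * μ k) := by
    intro k
    have h1 := condExp_bilin_of_stronglyMeasurable_right (μ := Pr) (innerSL ℝ)
      (f := e k) (hz k).stronglyMeasurable ((hIL k).integrable one_le_two)
      ((hL k).integrable one_le_two)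
    have h2 := condExp_smul (μ := Pr) (A k) (fun ω => ⟪e k ω, z k ω⟫_ℝ) (𝒢 k)
    filter_upwards [h1, h2, hμ k] with ω w1 w2 w3
    have hD0 : 0 ≤ D := (norm_nonneg _).trans (hD k ω)
    have w4 : (Pr[Z k | 𝒢 k]) ω = A k * ⟪(Pr[e k | 𝒢 k]) ω, z k ω⟫_ℝ := by
      refine w2.trans ?_
      rw [Pi.smul_apply, smul_eq_mul]
      exact congrArg (A k * ·) w1
    rw [w4, abs_mul, abs_of_nonneg (hA k)]
    have w5 := mul_le_mul_of_nonneg_left (hinner k ((Pr[e k | 𝒢 k]) ω) ω) (hA k)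
    have w6 := mul_le_mul_of_nonneg_left w3 (mul_nonneg (hA k) hD0)
    linarith
  filter_upwards [hconv, ae_all_iff.2 hce] with ω ⟨l, hl⟩ hce
  obtain ⟨R, hR⟩ := (Metric.isBounded_range_of_tendsto _ hl).exists_norm_le
  refine ⟨R + ∑' k, D * (A k * μ k), fun N => ?_⟩
  have h1 := (abs_le.1 (hR _ ⟨N, rfl⟩)).1
  simp only [Finset.sum_sub_distrib] at h1
  have h2 : -∑' k, D * (A k * μ k) ≤ ∑ k ∈ Finset.range N, (Pr[Z k | 𝒢 k]) ω := by
    refine le_trans (neg_le_neg ((hAμ.mul_left D).sum_le_tsum (Finset.range N)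
      fun k _ => (abs_nonneg _).trans (hce k))) ?_
    rw [← Finset.sum_neg_distrib]
    exact Finset.sum_le_sum fun k _ => (abs_le.1 (hce k)).1
  linarith

end Noise

/-! ### Measurability of the iterates with respect to the history. -/

section History

variable {Ω : Type*} {n m : ℕ} {x₀ : Ω → EuclideanSpace ℝ (Fin n)}
  {s : ℕ → Ω → Fin m} {ε : Fin m → ℕ → Ω → EuclideanSpace ℝ (Fin n)}

theorem measurable_realizedNoise [MeasurableSpace Ω] (hs : ∀ k, Measurable (s k)) (hε : ∀ i k, Measurable (ε i k))
    (k : ℕ) : Measurable (realizedNoise ε s k) := by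
  have : Measurable fun q : Fin m × Ω => ε q.1 k q.2 :=
    measurable_from_prod_countable_right fun i => hε i k
  exact this.comp ((hs k).prodMk measurable_id)

/-- The histories of the method form a filtration. -/
def historyFiltration [MeasurableSpace Ω] (hx₀ : Measurable x₀) (hs : ∀ k, Measurable (s k))
    (hε : ∀ i k, Measurable (ε i k)) : Filtration ℕ ‹MeasurableSpace Ω› where
  seq := history x₀ s ε
  mono' k l hkl := by
    refine sup_le_sup (sup_le_sup le_rfl ?_) ?_
    · exact biSup_mono fun i hi => le_trans hi hkl
    · exact biSup_mono fun i hi => ⟨hi.1, hi.2.trans hkl⟩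
  le' k := by
    refine sup_le (sup_le hx₀.comap_le ?_) ?_
    · exact iSup₂_le fun l _ => (hs l).comap_le
    · exact iSup₂_le fun l _ => (measurable_realizedNoise hs hε l).comap_le

theorem measurable_history_init (k : ℕ) : Measurable[history x₀ s ε k] x₀ :=
  measurable_iff_comap_le.2 (le_sup_left.trans le_sup_left)

theorem measurable_history_state {k l : ℕ} (h : l ≤ k) : Measurable[history x₀ s ε k] (s l) :=
  measurable_iff_comap_le.2 (((le_iSup₂_of_le (f := fun l (_ : l ∈ Set.Iic k) =>
    MeasurableSpace.comap (s l) inferInstance) l h le_rfl).trans le_sup_right).trans le_sup_left)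

theorem measurable_history_noise {k l : ℕ} (h : l ∈ Set.Icc 1 k) :
    Measurable[history x₀ s ε k] (realizedNoise ε s l) :=
  measurable_iff_comap_le.2 ((le_iSup₂_of_le (f := fun l (_ : l ∈ Set.Icc 1 k) =>
    MeasurableSpace.comap (realizedNoise ε s l) inferInstance) l h le_rfl).trans le_sup_right)

/-- This makes x_k - y an admissible multiplier for the noise entering at time k + 1. -/
theorem measurable_markovIterate [MeasurableSpace Ω] {X : Set (EuclideanSpace ℝ (Fin n))} (hX : IsClosed X)
    (hc : Convex ℝ X) (hne : X.Nonempty)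
    {g : Fin m → EuclideanSpace ℝ (Fin n) → EuclideanSpace ℝ (Fin n)}
    (hg : ∀ i, Measurable (g i)) (α : ℕ → ℝ)
    (hx₀ : Measurable x₀) (hs : ∀ k, Measurable (s k)) (hε : ∀ i k, Measurable (ε i k)) (k : ℕ) :
    Measurable[history x₀ s ε k] (markovIterate X g α s ε x₀ k) := by
  induction k with
  | zero => exact measurable_history_init 0
  | succ k ih =>
    have hx : Measurable[history x₀ s ε (k + 1)] (markovIterate X g α s ε x₀ k) :=
      ih.mono ((historyFiltration hx₀ hs hε).mono (Nat.le_succ k)) le_rfl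
    have hG : Measurable fun q : Fin m × EuclideanSpace ℝ (Fin n) => g q.1 q.2 :=
      measurable_from_prod_countable_right hg
    have hgs : Measurable[history x₀ s ε (k + 1)]
        fun ω => g (s (k + 1) ω) (markovIterate X g α s ε x₀ k ω) :=
      hG.comp ((measurable_history_state le_rfl).prodMk hx)
    have hn : Measurable[history x₀ s ε (k + 1)] (realizedNoise ε s (k + 1)) :=
      measurable_history_noise ⟨Nat.succ_le_succ (Nat.zero_le k), le_rfl⟩
    exact (measurable_euclProj hX hc hne).comp (hx.sub ((hgs.add hn).const_smul (α (k + 1))))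

theorem markovIterate_mem {X : Set (EuclideanSpace ℝ (Fin n))} (hX : IsClosed X)
    {g : Fin m → EuclideanSpace ℝ (Fin n) → EuclideanSpace ℝ (Fin n)} {α : ℕ → ℝ} {ω : Ω}
    (h : x₀ ω ∈ X) (k : ℕ) : markovIterate X g α s ε x₀ k ω ∈ X := by
  cases k with
  | zero => exact h
  | succ k => exact (euclProj_spec hX ⟨_, h⟩ _).1

end History

/-! ### Assembly of the almost sure statements. -/

theorem theorem4p1 {Ω : Type*} [MeasurableSpace Ω] (Pr : Measure Ω) [IsProbabilityMeasure Pr]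
    (n m : ℕ)
    -- the problem data: constraint set, agent functions, subgradients
    (X : Set (EuclideanSpace ℝ (Fin n))) (hXclosed : IsClosed X) (hXconvex : Convex ℝ X)
    (hXbdd : Bornology.IsBounded X)
    (f : Fin m → EuclideanSpace ℝ (Fin n) → ℝ) (hf : ∀ i, ConvexOn ℝ Set.univ (f i))
    (g : Fin m → EuclideanSpace ℝ (Fin n) → EuclideanSpace ℝ (Fin n))
    (hg_meas : ∀ i, Measurable (g i)) (hg : ∀ i, ∀ x ∈ X, IsSubgradientAt (f i) (g i x) x)
    -- the agent sequence and its transition matrices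
    (P : ℕ → Matrix (Fin m) (Fin m) ℝ) (s : ℕ → Ω → Fin m) (hs : IsMarkovChain Pr P s)
    (Q : ℕ) (hQ : 1 ≤ Q) (hconn : StronglyConnectedWithin P Q)
    (hdiag : ∀ k i, 0 < P k i i)
    (η : ℝ) (hη : 0 < η) (hPη : ∀ k i j, 0 < P k i j → η < P k i j)
    (hds : ∀ k, P k ∈ doublyStochastic ℝ (Fin m))
    -- the initial vector and the noise
    (x₀ : Ω → EuclideanSpace ℝ (Fin n)) (hx₀ : Measurable x₀) (hx₀X : ∀ ω, x₀ ω ∈ X)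
    (ε : Fin m → ℕ → Ω → EuclideanSpace ℝ (Fin n)) (hε : ∀ i k, Measurable (ε i k))
    (μ ν : ℕ → ℝ) (hν : ∀ k, 0 ≤ ν (k + 1)) (hnoise : NoiseMomentBounds Pr x₀ s ε μ ν)
    -- the step-size
    (a p : ℝ) (ha : 0 < a) (hp : 2 / 3 < p) (hp' : p ≤ 1)
    (hμ : Summable fun k : ℕ => stepSize a p (k + 1) * μ (k + 1))
    (hνbdd : BddAbove (Set.range fun k : ℕ => ν (k + 1))) :
    ∀ᵐ ω ∂Pr,
      liminf (fun k => netObjective f (markovIterate X g (stepSize a p) s ε x₀ k ω)) atTop =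
          optimalValue (netObjective f) X ∧
      liminf (fun k => Metric.infDist (markovIterate X g (stepSize a p) s ε x₀ k ω)
          (optimalSet (netObjective f) X)) atTop = 0 := by

  -- X is nonempty because a probability space has a point and x₀ takes its values in X.
  obtain ⟨ω₀⟩ : Nonempty Ω := Pr.nonempty_of_neZero
  have hne : X.Nonempty := ⟨_, hx₀X ω₀⟩
  have hXc : IsCompact X := Metric.isCompact_of_isClosed_isBounded hXclosed hXbdd
  have hcont : Continuous (netObjective f) := continuous_finsetSum _ fun i _ =>
    continuousOn_univ.1 ((hf i).continuousOn isOpen_univ)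
  obtain ⟨y, hy⟩ := optimalSet_nonempty hXc hne hcont.continuousOn
  choose C₀ hC₀ using fun i => exists_norm_subgradient_le hXc (hf i) (hg i)
  have hC : ∀ i, ∀ x ∈ X, ‖g i x‖ ≤ ∑ j, |C₀ j| := fun i x hx =>
    ((hC₀ i x hx).trans (le_abs_self _)).trans
      (Finset.single_le_sum (f := fun j => |C₀ j|) (fun j _ => abs_nonneg _) (Finset.mem_univ i))
  have hA := fun k : ℕ => stepSize_nonneg (p := p) ha (k + 1)
  have hAsq := summable_stepSize_succ_sq (a := a) (p := p) (by linarith)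
  have hAdiv := tendsto_sum_stepSize_succ ha hp'
  obtain ⟨V, hV⟩ := hνbdd
  have hV2 : ∀ k, ν (k + 1) ^ 2 ≤ V ^ 2 := fun k => pow_le_pow_left₀ (hν k) (hV ⟨k, rfl⟩) 2
  set 𝒢 := historyFiltration hx₀ hs.1 hε with h𝒢
  set e : ℕ → Ω → EuclideanSpace ℝ (Fin n) := fun k => realizedNoise ε s (k + 1) with he
  have hem : ∀ k, Measurable[𝒢 (k + 1)] (e k) := fun k =>
    measurable_history_noise ⟨Nat.succ_le_succ (Nat.zero_le k), le_rfl⟩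
  have heL : ∀ k, MemLp (e k) 2 Pr := fun k => (hnoise k).1
  have heμ : ∀ k, ∀ᵐ ω ∂Pr, ‖(Pr[e k | 𝒢 k]) ω‖ ≤ μ (k + 1) := fun k => (hnoise k).2.1
  have heV : ∀ k, ∀ᵐ ω ∂Pr, (Pr[fun ω' => ‖e k ω'‖ ^ 2 | 𝒢 k]) ω ≤ V ^ 2 := fun k =>
    (hnoise k).2.2.mono fun ω h => h.trans (hV2 k)
  set x := markovIterate X g (stepSize a p) s ε x₀ with hx
  have hxX : ∀ k ω, x k ω ∈ X := fun k ω => markovIterate_mem hXclosed (hx₀X ω) k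
  have hxm : ∀ k, Measurable[𝒢 k] fun ω => x k ω - y := fun k =>
    (measurable_markovIterate hXclosed hXconvex hne hg_meas _ hx₀ hs.1 hε k).sub_const y
  have hxD : ∀ k ω, ‖x k ω - y‖ ≤ Metric.diam X := fun k ω => by
    rw [← dist_eq_norm]; exact Metric.dist_le_diam_of_mem hXbdd (hxX k ω) hy.1
  -- The indicator of agent i minus 1/m has sum zero over the states and values in [-1, 1], so the
  -- weighted chain theorem applies.
  have hfreq : ∀ i : Fin m, ∀ᵐ ω ∂Pr, ∃ l, Tendsto (fun N => ∑ k ∈ Finset.range N,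
      stepSize a p (k + 1) * ((if s (k + 1) ω = i then 1 else 0) - (m : ℝ)⁻¹)) atTop (𝓝 l) := by
    intro i
    have hm : (1 : ℝ) ≤ m := by
      exact_mod_cast Nat.one_le_iff_ne_zero.2 (by rintro rfl; exact i.elim0)
    refine hs.ae_exists_tendsto_weighted_sum hη hds hdiag hPη hQ hconn
      (antitone_stepSize_succ ha (by linarith)) hA hAsq
      (v := fun j => (if j = i then 1 else 0) - (m : ℝ)⁻¹) ?_ fun j => ?_
    · rw [Finset.sum_sub_distrib]
      simp [mul_inv_cancel₀ (show (m : ℝ) ≠ 0 by positivity)]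
    · have h1 : (m : ℝ)⁻¹ ≤ 1 := inv_le_one_of_one_le₀ hm
      have h2 : (0 : ℝ) ≤ (m : ℝ)⁻¹ := by positivity
      split_ifs <;> rw [abs_le] <;> constructor <;> linarith
  filter_upwards [ae_all_iff.2 hfreq, ae_summable_sq_noise heL heV hAsq,
    ae_exists_sum_norm_noise_le hem heL heV hA hAsq,
    ae_exists_le_sum_inner_noise hem heL heV heμ hA hAsq hμ hxm hxD] with ω h1 h2 h3 h4
  -- The exceptional null set was fixed before δ, so one ω serves every δ.
  have key : ∀ δ > 0, ∃ᶠ k in atTop, netObjective f (x k ω) - netObjective f y < δ :=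
    fun δ hδ => frequently_netObjective_sub_lt hXclosed hXconvex hXbdd hg hC hA hAdiv hAsq
      (fun k => hxX k ω) (fun k => rfl) hy.1 h1 h4 h2 h3 hδ
  refine ⟨?_, liminf_eq_of_frequently_lt (fun k => Metric.infDist_nonneg) fun δ hδ => ?_⟩
  · rw [optimalValue_eq hy]
    exact liminf_eq_of_frequently_lt (fun k => hy.2 _ (hxX k ω)) fun δ hδ =>
      (key δ hδ).mono fun k hk => sub_lt_iff_lt_add'.1 hk
  · obtain ⟨δ', hδ', hgap⟩ := exists_gap_of_infDist hXc hcont hy hδ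
    exact (key δ' hδ').mono fun k hk => by
      rw [zero_add]; exact hgap _ (hxX k ω) hk
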